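/- Let $X_j$, $j\ge 0$, be a random walk in $\mathbb Z^2$ with i.i.d. increments, i.e. $X_j=X_0+\xi_1+\dots+\xi_j$, that is symmetric ($p_1(-z)=p_1(z)$ for all $z$, where $p_1(z)=\mathbb P(\xi_1=z)$) and strongly aperiodic (for every $t\in\mathbb Z^2$ the set $\{t+z : p_1(z)>0\}$ generates the group $\mathbb Z^2$). Suppose that the covariance matrix of $\xi_1$ is the identity and that, for some $\beta>0$, $\mathbb E|\xi_1|^{3+2\beta}<\infty$, where $|\cdot|$ is the Euclidean norm. Let $D(x,r)=\{y\in\mathbb Z^2: |y-x|<r\}$, and for $A\subseteq\mathbb Z^2$ and $x,y\in A$ let $$G_A(x,y)=\sum_{i=0}^\infty \mathbb P^x(X_i=y,\ i<T_{A^c}),\qquad T_B=\inf\{i\ge 0: X_i\in B\},$$ where $\mathbb P^x$ is the law of the walk started at $x$. Then for any $0<\delta<\varepsilon<1$ there exist constants $0<c_1<c_2<\infty$ such that for all sufficiently large real $n$, all $x\in D(0,n)\setminus D(0,\varepsilon n)$ and all $y\in D(0,\delta n)$, $$c_1\,\frac{\rho(x)\vee 1}{n}\ \le\ G_{D(0,n)}(y,x)\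 \le\ c_2\,\frac{\rho(x)\vee 1}{n},\qquad \rho(x)=n-|x|.$$ -/

import Mathlib

open MeasureTheory ProbabilityTheory Filter
open scoped ENNReal

noncomputable section

/-- The planar integer lattice. -/
abbrev Z2 : Type := Fin 2 → ℤ

/-- The Euclidean length `|x|` of a lattice point. -/
def Z2.len (x : Z2) : ℝ := Real.sqrt (∑ i, ((x i : ℤ) : ℝ) ^ 2)

/-- The lattice disk `D(x, r) = {y ∈ ℤ² : |y - x| < r}`. -/
def disk (x : Z2) (r : ℝ) : Set Z2 := {y | Z2.len (y - x) < r}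

variable {Ω : Type*} [MeasurableSpace Ω]

/-- The random walk started at `x` with increments `ξ 0, ξ 1, …`:
at time `n` it is at `x + ξ 0 + ⋯ + ξ (n - 1)`. Its law under `μ` is the law of the walk
under `P^x`. -/
def walk (ξ : ℕ → Ω → Z2) (x : Z2) (n : ℕ) (ω : Ω) : Z2 :=
  x + ∑ k ∈ Finset.range n, ξ k ω

/-- The first hitting time `T_B = inf {i ≥ 0 : X_i ∈ B}` of the walk started at `x`
(it is `⊤` if `B` is never hit). -/
def hitTime (ξ : ℕ → Ω → Z2) (x : Z2) (B : Set Z2) : Ω → WithTop ℕ :=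
  hittingAfter (walk ξ x) B 0

/-- The Green's function `G_A(x, y) = ∑_{i ≥ 0} P^x(X_i = y, i < T_{Aᶜ})` of the walk killed on
leaving `A`, with values in `[0, ∞]`. -/
def green (μ : Measure Ω) (ξ : ℕ → Ω → Z2) (A : Set Z2) (x y : Z2) : ℝ≥0∞ :=
  ∑' i : ℕ, μ {ω | walk ξ x i ω = y ∧ (i : WithTop ℕ) < hitTime ξ x Aᶜ ω}

/-- The one-step transition probabilities `p₁(z) = P(ξ 0 = z)`. -/
def stepProb (μ : Measure Ω) (ξ : ℕ → Ω → Z2) (z : Z2) : ℝ := μ.real {ω | ξ 0 ω = z}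

/-- Strong aperiodicity (Spitzer): for every `t ∈ ℤ²`, the translate by `t` of the set of
possible steps generates the whole group `ℤ²`. -/
def StronglyAperiodic (p : Z2 → ℝ) : Prop :=
  ∀ t : Z2, AddSubgroup.closure {w : Z2 | ∃ z, p z ≠ 0 ∧ w = t + z} = ⊤

/-- The increments are independent and identically distributed, and the walk is symmetric,
strongly aperiodic, with identity covariance matrix and `E|X₁|^(3+2β) < ∞`. -/
structure IsWalkSteps (μ : Measure Ω) (β : ℝ) (ξ : ℕ → Ω → Z2) : Prop where
  measurable : ∀ k, Measurable (ξ k)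
  indep : iIndepFun ξ μ
  identDistrib : ∀ k, IdentDistrib (ξ k) (ξ 0) μ μ
  symmetric : ∀ z, stepProb μ ξ (-z) = stepProb μ ξ z
  aperiodic : StronglyAperiodic (stepProb μ ξ)
  cov_eq : ∀ i j : Fin 2,
    cov[fun ω => ((ξ 0 ω i : ℤ) : ℝ), fun ω => ((ξ 0 ω j : ℤ) : ℝ); μ]
      = (1 : Matrix (Fin 2) (Fin 2) ℝ) i j
  moment : Integrable (fun ω => Z2.len (ξ 0 ω) ^ (3 + 2 * β)) μ

end

/-! ### The killed walk and the recursion for its Green's function -/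

section Reduction

variable {Ω : Type*}

/-! The proof compares the Green's function with explicit functions through the minimum principle
`StepLaw.nonneg_of_superharmonic`; neither a local limit theorem nor potential kernel asymptotics
enter. Each trial function is expanded to second order with a remainder bounded by a multiple of
`|z|³`. The drift then depends only on symmetry, the identity covariance and the third moment, which
together with generation of the lattice form `StepLaw`. The walk enters through two facts: its
Green's function satisfies a first-step equation, and it lies below every nonnegative supersolution.

Upper bound. A truncated, regularised logarithm is a supersolution
(`exists_logPotential_supersolution`), so the Green's function is finite, and it is bounded at
distance of order `n` from the pole. In an annulus next to the boundary it is compared with `1/n`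
times a concave function of `(n² - |x|²)/n + a` (`exists_boundary_barrier`), which is at most a
multiple of `ρ ∨ 1`. The barrier has drift at most `-2/n`, and this pays for the rare long jumps
towards the pole (`exists_green_le`).

Lower bound. A logarithm that is superharmonic off a fixed disk shows that the Green's functions
with poles in a small disk have a sum bounded below near the centre. Symmetry and a local Harnack
inequality reduce this sum to a single pole (`exists_le_green_center`). An exponential subsolution
carries the bound outwards, linearly in the distance to the boundary; using this twice, with
symmetry in between, allows every pole in `D(0, δn)` (`exists_le_green`). Within distance one of the
boundary the linear bound is too weak. There one step of the walk moves inwards by an amount of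
order one on average, which gives order `1/n` (`exists_le_green_boundary`). -/

lemma lt_hitTime_iff (ξ : ℕ → Ω → Z2) (x : Z2) (A : Set Z2) (ω : Ω) (i : ℕ) :
    (i : WithTop ℕ) < hitTime ξ x Aᶜ ω ↔ ∀ j ≤ i, walk ξ x j ω ∈ A := by
  have h := hittingAfter_le_iff (u := walk ξ x) (s := Aᶜ) (n := 0) (i := i) (ω := ω)
  rw [← not_le, hitTime]
  refine (not_congr h).trans ?_
  simp

lemma walk_succ (ξ : ℕ → Ω → Z2) (x : Z2) (i : ℕ) (ω : Ω) :
    walk ξ x (i + 1) ω = walk ξ x i ω + ξ i ω := by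
  simp [walk, Finset.sum_range_succ, add_assoc]

/-- The event that the walk started at `y` and killed on leaving `A` is at `w` at time `i`. -/
def killedAt (ξ : ℕ → Ω → Z2) (A : Set Z2) (y : Z2) (i : ℕ) (w : Z2) : Set Ω :=
  {ω | walk ξ y i ω = w ∧ ∀ j ≤ i, walk ξ y j ω ∈ A}

lemma killedAt_zero (ξ : ℕ → Ω → Z2) {A : Set Z2} {y : Z2} (hy : y ∈ A) (w : Z2) :
    killedAt ξ A y 0 w = if w = y then Set.univ else ∅ := by
  ext ω
  by_cases h : w = y
  · simp [killedAt, walk, h, hy]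
  · simp [killedAt, walk, h, Ne.symm h]

lemma killedAt_eq_empty (ξ : ℕ → Ω → Z2) {A : Set Z2} {w : Z2} (y : Z2) (i : ℕ) (hw : w ∉ A) :
    killedAt ξ A y i w = ∅ := by
  ext ω
  simp only [killedAt, Set.mem_ofPred_eq, Set.mem_empty_iff_false, iff_false, not_and]
  intro h h'
  exact hw (h ▸ h' i le_rfl)

lemma killedAt_succ (ξ : ℕ → Ω → Z2) {A : Set Z2} {w : Z2} (y : Z2) (i : ℕ) (hw : w ∈ A) :
    killedAt ξ A y (i + 1) w = ⋃ z, killedAt ξ A y i (w - z) ∩ ξ i ⁻¹' {z} := by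
  ext ω
  simp only [killedAt, Set.mem_ofPred_eq, Set.mem_iUnion, Set.mem_inter_iff, Set.mem_preimage,
    Set.mem_singleton_iff, walk_succ]
  constructor
  · rintro ⟨h, h'⟩
    exact ⟨ξ i ω, ⟨by simp [← h], fun j hj => h' j (by lia)⟩, rfl⟩
  · rintro ⟨z, ⟨h, h'⟩, rfl⟩
    refine ⟨by simp [h], fun j hj => ?_⟩
    rcases Nat.lt_or_ge i j with hij | hij
    · obtain rfl : j = i + 1 := by lia
      rw [walk_succ, h]
      simpa using hw
    · exact h' j hij

/-- The event `killedAt ξ A y i w` only depends on the first `i` increments. -/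
lemma killedAt_eq_preimage (ξ : ℕ → Ω → Z2) (A : Set Z2) (y : Z2) (i : ℕ) (w : Z2) :
    ∃ S : Set (Finset.range i → Z2),
      killedAt ξ A y i w = (fun ω (k : Finset.range i) => ξ k ω) ⁻¹' S := by
  -- A position at time `j ≤ i` is written as a sum over all `i` increments padded by zero, since
  -- only the full vector of them is available.
  refine ⟨{f | y + ∑ k : Finset.range i, f k = w ∧
    ∀ j ≤ i, y + ∑ k : Finset.range i, (if (k : ℕ) < j then f k else 0) ∈ A}, ?_⟩
  ext ω
  have h1 : ∑ k : Finset.range i, ξ k ω = ∑ k ∈ Finset.range i, ξ k ω :=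
    Finset.sum_coe_sort (Finset.range i) (fun k => ξ k ω)
  have h2 : ∀ j ≤ i, ∑ k : Finset.range i, (if (k : ℕ) < j then ξ k ω else 0)
      = ∑ k ∈ Finset.range j, ξ k ω := by
    intro j hj
    rw [Finset.sum_coe_sort (Finset.range i) (fun k => if k < j then ξ k ω else 0),
      ← Finset.sum_filter]
    congr 1
    ext k
    simp only [Finset.mem_filter, Finset.mem_range]
    lia
  simp only [killedAt, walk, Set.mem_ofPred_eq, Set.mem_preimage, h1]
  refine and_congr Iff.rfl (forall_congr' fun j => ?_)
  refine forall_congr' fun hj => ?_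
  rw [h2 j hj]

variable [MeasurableSpace Ω]

lemma green_eq_tsum (μ : Measure Ω) (ξ : ℕ → Ω → Z2) (A : Set Z2) (y w : Z2) :
    green μ ξ A y w = ∑' i, μ (killedAt ξ A y i w) := by
  simp only [green, killedAt, lt_hitTime_iff]

lemma green_eq_zero (μ : Measure Ω) (ξ : ℕ → Ω → Z2) {A : Set Z2} (y : Z2) {w : Z2} (hw : w ∉ A) :
    green μ ξ A y w = 0 := by
  simp [green_eq_tsum, killedAt_eq_empty ξ y _ hw]

variable {μ : Measure Ω} {ξ : ℕ → Ω → Z2}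

lemma measurableSet_killedAt (hm : ∀ k, Measurable (ξ k)) (A : Set Z2) (y : Z2) (i : ℕ)
    (w : Z2) : MeasurableSet (killedAt ξ A y i w) := by
  obtain ⟨S, hS⟩ := killedAt_eq_preimage ξ A y i w
  have h : Measurable fun ω (k : Finset.range i) => ξ k ω := measurable_pi_lambda _ fun k => hm k
  rw [hS]
  exact h (Set.to_countable S).measurableSet

lemma measure_killedAt_inter (hm : ∀ k, Measurable (ξ k)) (hi : iIndepFun ξ μ) (A : Set Z2)
    (y : Z2) (i : ℕ) (w z : Z2) :
    μ (killedAt ξ A y i w ∩ ξ i ⁻¹' {z}) = μ (killedAt ξ A y i w) * μ (ξ i ⁻¹' {z}) := by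
  obtain ⟨S, hS⟩ := killedAt_eq_preimage ξ A y i w
  have hind := hi.indepFun_finset (Finset.range i) {i} (by simp) hm
  have h := hind.measure_inter_preimage_eq_mul S
    {f : ({i} : Finset ℕ) → Z2 | f ⟨i, by simp⟩ = z} (Set.to_countable S).measurableSet
    (Set.to_countable _).measurableSet
  rw [hS]
  exact h

/-- The last-step decomposition of the killed walk. -/
lemma measure_killedAt_succ (hm : ∀ k, Measurable (ξ k)) (hi : iIndepFun ξ μ)
    (hid : ∀ k, IdentDistrib (ξ k) (ξ 0) μ μ) (ν : Measure Z2) (hν : ν = μ.map (ξ 0))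
    (hneg : ∀ z, ν {-z} = ν {z}) {A : Set Z2} (y : Z2) (i : ℕ) {w : Z2} (hw : w ∈ A) :
    μ (killedAt ξ A y (i + 1) w) = ∫⁻ z, μ (killedAt ξ A y i (w + z)) ∂ν := by
  rw [killedAt_succ ξ y i hw, measure_iUnion]
  -- The last step leads from `w - z` to `w`; reflecting `z` and using symmetry of the step law
  -- turns this into an average over `w + z`.
  · rw [lintegral_countable', ← (Equiv.neg Z2).tsum_eq]
    refine tsum_congr fun z => ?_
    rw [measure_killedAt_inter hm hi, Equiv.neg_apply, sub_neg_eq_add, ← hneg z, hν,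
      Measure.map_apply (hm 0) (measurableSet_singleton _)]
    congr 1
    exact (hid i).measure_mem_eq (measurableSet_singleton _)
  · intro a b hab
    refine Set.disjoint_left.2 ?_
    rintro ω ⟨-, ha⟩ ⟨-, hb⟩
    exact hab (ha.symm.trans hb)
  · intro z
    exact (measurableSet_killedAt hm A y i _).inter (hm i (measurableSet_singleton z))

variable [IsProbabilityMeasure μ]

/-- The first-step equation for the Green's function in its second variable. -/
lemma green_eq_add_lintegral (hm : ∀ k, Measurable (ξ k)) (hi : iIndepFun ξ μ)
    (hid : ∀ k, IdentDistrib (ξ k) (ξ 0) μ μ) (ν : Measure Z2) (hν : ν = μ.map (ξ 0))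
    (hneg : ∀ z, ν {-z} = ν {z}) {A : Set Z2} {y w : Z2} (hy : y ∈ A) (hw : w ∈ A) :
    green μ ξ A y w = (if w = y then 1 else 0) + ∫⁻ z, green μ ξ A y (w + z) ∂ν := by
  simp only [green_eq_tsum]
  rw [tsum_eq_zero_add' ENNReal.summable, killedAt_zero ξ hy,
    lintegral_tsum fun i => (Measurable.of_discrete).aemeasurable]
  congr 1
  · split_ifs <;> simp
  · exact tsum_congr fun i => measure_killedAt_succ hm hi hid ν hν hneg y i hw

/-- The Green's function is the least nonnegative supersolution. -/
lemma green_le_of_supersolution (hm : ∀ k, Measurable (ξ k)) (hi : iIndepFun ξ μ)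
    (hid : ∀ k, IdentDistrib (ξ k) (ξ 0) μ μ) (ν : Measure Z2) (hν : ν = μ.map (ξ 0))
    (hneg : ∀ z, ν {-z} = ν {z}) {A : Set Z2} {y : Z2} (hy : y ∈ A) (U : Z2 → ℝ≥0∞)
    (hU : ∀ w ∈ A, (if w = y then 1 else 0) + ∫⁻ z, U (w + z) ∂ν ≤ U w) (w : Z2) :
    green μ ξ A y w ≤ U w := by
  -- Partial sums in time are iterates of the first-step operator started from zero, so they stay
  -- below any supersolution.
  have key : ∀ N w, ∑ i ∈ Finset.range N, μ (killedAt ξ A y i w) ≤ U w := by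
    intro N
    induction N with
    | zero => simp
    | succ N ih =>
      intro w
      by_cases hw : w ∈ A
      · refine le_trans ?_ (hU w hw)
        rw [Finset.sum_range_succ', killedAt_zero ξ hy, add_comm]
        refine add_le_add ?_ ?_
        · split_ifs <;> simp
        · simp only [measure_killedAt_succ hm hi hid ν hν hneg y _ hw]
          rw [← lintegral_finsetSum' _ fun i _ => (Measurable.of_discrete).aemeasurable]
          exact lintegral_mono fun z => ih (w + z)
      · simp [killedAt_eq_empty ξ y _ hw]
  rw [green_eq_tsum, ENNReal.tsum_eq_iSup_nat]
  exact iSup_le fun N => key N w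

end Reduction

/-! ### Euclidean geometry of the lattice -/

namespace Z2

/-- The Euclidean inner product of two lattice points. -/
noncomputable def dot (x z : Z2) : ℝ := ∑ i, (x i : ℝ) * (z i : ℝ)

lemma len_nonneg (x : Z2) : 0 ≤ len x := Real.sqrt_nonneg _

lemma len_sq (x : Z2) : len x ^ 2 = (x 0 : ℝ) ^ 2 + (x 1 : ℝ) ^ 2 := by
  rw [len, Real.sq_sqrt (Finset.sum_nonneg fun i _ => sq_nonneg _), Fin.sum_univ_two]

lemma dot_eq (x z : Z2) : dot x z = (x 0 : ℝ) * z 0 + (x 1 : ℝ) * z 1 := by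
  rw [dot, Fin.sum_univ_two]

lemma len_add_sq (x z : Z2) : len (x + z) ^ 2 = len x ^ 2 + 2 * dot x z + len z ^ 2 := by
  simp only [len_sq, dot_eq, Pi.add_apply, Int.cast_add]
  ring

lemma dot_sq_le (x z : Z2) : dot x z ^ 2 ≤ len x ^ 2 * len z ^ 2 := by
  simp only [len_sq, dot_eq]
  nlinarith [sq_nonneg ((x 0 : ℝ) * z 1 - (x 1 : ℝ) * z 0)]

lemma abs_dot_le (x z : Z2) : |dot x z| ≤ len x * len z := by
  refine abs_le_of_sq_le_sq ?_ (mul_nonneg (len_nonneg x) (len_nonneg z))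
  rw [mul_pow]
  exact dot_sq_le x z

lemma len_add_le (x z : Z2) : len (x + z) ≤ len x + len z := by
  refine le_of_sq_le_sq ?_ (add_nonneg (len_nonneg x) (len_nonneg z))
  rw [len_add_sq]
  nlinarith [le_of_abs_le (abs_dot_le x z)]

lemma len_neg (x : Z2) : len (-x) = len x := by
  simp [len]

lemma dot_neg (x z : Z2) : dot x (-z) = -dot x z := by
  simp [dot]

lemma len_zero : len 0 = 0 := by
  simp [len]

lemma len_sub_le (x y : Z2) : len (x - y) ≤ len x + len y := by
  simpa [sub_eq_add_neg, len_neg] using len_add_le x (-y)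

lemma len_le_add_sub (x y : Z2) : len x ≤ len y + len (x - y) := by
  simpa using len_add_le y (x - y)

lemma one_le_len {x : Z2} (hx : x ≠ 0) : 1 ≤ len x := by
  rw [← one_le_sq_iff₀ (len_nonneg x), len_sq]
  obtain ⟨i, hi⟩ : ∃ i, x i ≠ 0 := Function.ne_iff.1 hx
  have h : (1 : ℝ) ≤ (x i : ℝ) ^ 2 := by
    have h1 : (1 : ℤ) ≤ x i ^ 2 := by
      have := sq_pos_of_ne_zero hi
      lia
    exact_mod_cast h1
  fin_cases i
  · exact h.trans (le_add_of_nonneg_right (sq_nonneg _))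
  · exact h.trans (le_add_of_nonneg_left (sq_nonneg _))

lemma abs_apply_le (x : Z2) (i : Fin 2) : |(x i : ℝ)| ≤ len x := by
  refine abs_le_of_sq_le_sq ?_ (len_nonneg x)
  rw [len_sq]
  fin_cases i
  · exact le_add_of_nonneg_right (sq_nonneg _)
  · exact le_add_of_nonneg_left (sq_nonneg _)

end Z2

open Z2

lemma mem_disk_zero {x : Z2} {r : ℝ} : x ∈ disk 0 r ↔ len x < r := by
  simp [disk]

lemma finite_disk_zero (r : ℝ) : (disk 0 r).Finite := by
  refine (Set.finite_Icc (fun _ => ⌊-r⌋ : Z2) (fun _ => ⌈r⌉)).subset fun x hx => ?_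
  rw [mem_disk_zero] at hx
  refine ⟨fun i => ?_, fun i => ?_⟩
  · have h := (abs_le.1 (abs_apply_le x i)).1
    exact_mod_cast (Int.floor_le (-r)).trans (by linarith : -r ≤ (x i : ℝ))
  · have h := (abs_le.1 (abs_apply_le x i)).2
    exact_mod_cast (by linarith : (x i : ℝ) ≤ r).trans (Int.le_ceil r)

/-! ### Step distributions -/

/-- A symmetric step distribution with identity covariance and a third moment, whose support
generates the lattice. -/
structure StepLaw (ν : Measure Z2) : Prop where
  neg : ∀ z, ν {-z} = ν {z}
  integrable_cube : Integrable (fun z => len z ^ 3) ν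
  second : ∀ i j : Fin 2, ∫ z, (z i : ℝ) * (z j : ℝ) ∂ν = (1 : Matrix (Fin 2) (Fin 2) ℝ) i j
  gen : AddSubgroup.closure {z | ν {z} ≠ 0} = ⊤

/-- The third absolute moment. -/
noncomputable def cubeMoment (ν : Measure Z2) : ℝ := ∫ z, len z ^ 3 ∂ν

lemma cubeMoment_nonneg (ν : Measure Z2) : 0 ≤ cubeMoment ν :=
  integral_nonneg fun z => pow_nonneg (len_nonneg z) 3

namespace StepLaw

variable {ν : Measure Z2}

lemma map_neg_of_singleton (hν : ∀ z, ν {-z} = ν {z}) : ν.map (fun z => -z) = ν := by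
  refine Measure.ext_of_singleton fun z => ?_
  rw [Measure.map_apply Measurable.of_discrete (measurableSet_singleton z)]
  simpa using hν z

lemma integral_neg_of_singleton (hν : ∀ z, ν {-z} = ν {z}) (f : Z2 → ℝ) :
    ∫ z, f (-z) ∂ν = ∫ z, f z ∂ν := by
  conv_rhs => rw [← map_neg_of_singleton hν]
  rw [integral_map (Measurable.of_discrete).aemeasurable
    (Measurable.of_discrete).aestronglyMeasurable]

lemma integral_dot (hν : StepLaw ν) (x : Z2) : ∫ z, dot x z ∂ν = 0 := by
  have h := integral_neg_of_singleton hν.neg (dot x)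
  simp only [dot_neg, integral_neg] at h
  linarith

/-- A step law concentrated at the origin would generate only the trivial subgroup. The step found
here drives the minimum principle. -/
lemma exists_ne_zero (hν : StepLaw ν) : ∃ z, z ≠ 0 ∧ ν {z} ≠ 0 := by
  by_contra! h
  have h1 : AddSubgroup.closure {z | ν {z} ≠ 0} ≤ (⊥ : AddSubgroup Z2) := by
    rw [AddSubgroup.closure_le]
    intro z hz
    by_contra h0
    exact hz (h z h0)
  rw [hν.gen] at h1
  have h2 : (1 : Z2) ∈ (⊥ : AddSubgroup Z2) := h1 trivial
  have h3 := congrFun ((AddSubgroup.mem_bot).1 h2) 0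
  simp at h3

variable [IsProbabilityMeasure ν]

lemma integrable_of_abs_le (hν : StepLaw ν) {f : Z2 → ℝ} {a b : ℝ}
    (hf : ∀ z, |f z| ≤ a + b * len z ^ 3) : Integrable f ν :=
  ((integrable_const a).add (hν.integrable_cube.const_mul b)).mono'
    (Measurable.of_discrete).aestronglyMeasurable (ae_of_all _ hf)

lemma integrable_len_sq (hν : StepLaw ν) : Integrable (fun z => len z ^ 2) ν := by
  refine hν.integrable_of_abs_le (a := 1) (b := 1) fun z => ?_
  rw [abs_of_nonneg (by positivity)]
  have := len_nonneg z
  rcases le_total (len z) 1 with h | h <;> nlinarith [pow_nonneg this 2, pow_nonneg this 3]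

lemma integrable_dot (hν : StepLaw ν) (x : Z2) : Integrable (fun z => dot x z) ν := by
  refine hν.integrable_of_abs_le (a := len x) (b := len x) fun z => ?_
  refine (abs_dot_le x z).trans ?_
  have h0 := len_nonneg x
  have : len z ≤ 1 + len z ^ 3 := by
    have := len_nonneg z
    rcases le_total (len z) 1 with h | h <;>
      nlinarith [pow_nonneg this 2, pow_nonneg this 3, mul_nonneg this (sub_nonneg.2 h)]
  nlinarith

lemma integrable_dot_sq (hν : StepLaw ν) (x : Z2) : Integrable (fun z => dot x z ^ 2) ν := by
  refine (hν.integrable_len_sq.const_mul (len x ^ 2)).mono'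
    (Measurable.of_discrete).aestronglyMeasurable (ae_of_all _ fun z => ?_)
  rw [Real.norm_eq_abs, abs_of_nonneg (sq_nonneg _)]
  exact dot_sq_le x z

lemma integrable_mul (hν : StepLaw ν) (i j : Fin 2) :
    Integrable (fun z : Z2 => (z i : ℝ) * (z j : ℝ)) ν := by
  refine hν.integrable_len_sq.mono' (Measurable.of_discrete).aestronglyMeasurable
    (ae_of_all _ fun z => ?_)
  rw [Real.norm_eq_abs, abs_mul, sq]
  exact mul_le_mul (abs_apply_le z i) (abs_apply_le z j) (abs_nonneg _) (len_nonneg z)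

lemma integral_len_sq (hν : StepLaw ν) : ∫ z, len z ^ 2 ∂ν = 2 := by
  simp only [len_sq]
  simp only [sq]
  rw [integral_add (hν.integrable_mul 0 0) (hν.integrable_mul 1 1), hν.second, hν.second]
  norm_num

lemma integral_dot_sq (hν : StepLaw ν) (x : Z2) : ∫ z, dot x z ^ 2 ∂ν = len x ^ 2 := by
  have h : ∀ z, dot x z ^ 2 = (x 0 : ℝ) ^ 2 * ((z 0 : ℝ) * z 0)
      + 2 * (x 0 : ℝ) * x 1 * ((z 0 : ℝ) * z 1) + (x 1 : ℝ) ^ 2 * ((z 1 : ℝ) * z 1) := by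
    intro z
    rw [dot_eq]
    ring
  simp only [h]
  have h0 := (hν.integrable_mul 0 0).const_mul ((x 0 : ℝ) ^ 2)
  have h1 := (hν.integrable_mul 0 1).const_mul (2 * (x 0 : ℝ) * x 1)
  have h01 : Integrable (fun z : Z2 => (x 0 : ℝ) ^ 2 * ((z 0 : ℝ) * z 0)
      + 2 * (x 0 : ℝ) * x 1 * ((z 0 : ℝ) * z 1)) ν := h0.add h1
  rw [integral_add h01 ((hν.integrable_mul 1 1).const_mul _), integral_add h0 h1,
    integral_const_mul, integral_const_mul,
    integral_const_mul, hν.second, hν.second, hν.second, len_sq]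
  simp

/-- A polynomial of the step adapted to second-order Taylor bounds. -/
noncomputable def _root_.taylorPoly (x : Z2) (c : Fin 5 → ℝ) (z : Z2) : ℝ :=
  c 0 + c 1 * dot x z + c 2 * len z ^ 2 + c 3 * dot x z ^ 2 + c 4 * len z ^ 3

lemma integrable_taylorPoly (hν : StepLaw ν) (x : Z2) (c : Fin 5 → ℝ) :
    Integrable (taylorPoly x c) ν :=
  ((((integrable_const _).add ((hν.integrable_dot x).const_mul _)).add
    (hν.integrable_len_sq.const_mul _)).add ((hν.integrable_dot_sq x).const_mul _)).add
    (hν.integrable_cube.const_mul _)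

/-- The linear term vanishes by symmetry, and the identity covariance gives `E|z|² = 2` and `E(x·z)²
= |x|²`. All drift computations reduce to this formula. -/
lemma integral_taylorPoly (hν : StepLaw ν) (x : Z2) (c : Fin 5 → ℝ) :
    ∫ z, taylorPoly x c z ∂ν = c 0 + 2 * c 2 + c 3 * len x ^ 2 + c 4 * cubeMoment ν := by
  have h0 := integrable_const (μ := ν) (c 0)
  have h1 := (hν.integrable_dot x).const_mul (c 1)
  have h2 := hν.integrable_len_sq.const_mul (c 2)
  have h3 := (hν.integrable_dot_sq x).const_mul (c 3)
  have h4 := hν.integrable_cube.const_mul (c 4)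
  have h01 : Integrable (fun z => c 0 + c 1 * dot x z) ν := h0.add h1
  have h02 : Integrable (fun z => c 0 + c 1 * dot x z + c 2 * len z ^ 2) ν := h01.add h2
  have h03 : Integrable (fun z => c 0 + c 1 * dot x z + c 2 * len z ^ 2 + c 3 * dot x z ^ 2) ν :=
    h02.add h3
  simp only [taylorPoly]
  rw [integral_add h03 h4, integral_add h02 h3, integral_add h01 h2, integral_add h0 h1, integral_const_mul, integral_const_mul,
    integral_const_mul, integral_const_mul, hν.integral_dot, hν.integral_len_sq,
    hν.integral_dot_sq, cubeMoment]
  simp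
  ring

lemma integral_le_of_le_taylorPoly (hν : StepLaw ν) {f : Z2 → ℝ} (hf : Integrable f ν) (x : Z2)
    (c₀ c₁ c₂ c₃ c₄ : ℝ)
    (h : ∀ z, f z ≤ c₀ + c₁ * dot x z + c₂ * len z ^ 2 + c₃ * dot x z ^ 2 + c₄ * len z ^ 3) :
    ∫ z, f z ∂ν ≤ c₀ + 2 * c₂ + c₃ * len x ^ 2 + c₄ * cubeMoment ν := by
  have := hν.integral_taylorPoly x ![c₀, c₁, c₂, c₃, c₄]
  refine (integral_mono hf (hν.integrable_taylorPoly x ![c₀, c₁, c₂, c₃, c₄])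
    (fun z => ?_)).trans this.le
  simpa [taylorPoly] using h z

lemma le_integral_of_taylorPoly_le (hν : StepLaw ν) {f : Z2 → ℝ} (hf : Integrable f ν) (x : Z2)
    (c₀ c₁ c₂ c₃ c₄ : ℝ)
    (h : ∀ z, c₀ + c₁ * dot x z + c₂ * len z ^ 2 + c₃ * dot x z ^ 2 + c₄ * len z ^ 3 ≤ f z) :
    c₀ + 2 * c₂ + c₃ * len x ^ 2 + c₄ * cubeMoment ν ≤ ∫ z, f z ∂ν := by
  have := hν.integral_taylorPoly x ![c₀, c₁, c₂, c₃, c₄]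
  refine this.ge.trans (integral_mono (hν.integrable_taylorPoly x ![c₀, c₁, c₂, c₃, c₄]) hf
    (fun z => ?_))
  simpa [taylorPoly] using h z

lemma integrable_of_finite_support {A : Set Z2} (hA : A.Finite) {f : Z2 → ℝ}
    (hf : ∀ x ∉ A, f x = 0) (x : Z2) : Integrable (fun z => f (x + z)) ν := by
  obtain ⟨C, hC⟩ := (hA.image fun u => |f u|).bddAbove
  refine (integrable_const (max C 0)).mono' (Measurable.of_discrete).aestronglyMeasurable
    (ae_of_all _ fun z => ?_)
  by_cases h : x + z ∈ A
  · exact le_max_of_le_left (hC ⟨x + z, h, rfl⟩)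
  · simp [hf _ h]

/-- The minimum principle: a function superharmonic on a finite set and nonnegative off it is
nonnegative. -/
lemma nonneg_of_superharmonic (hν : StepLaw ν) {A : Set Z2} (hA : A.Finite) {f : Z2 → ℝ}
    (hi : ∀ x ∈ A, Integrable (fun z => f (x + z)) ν) (hoff : ∀ x ∉ A, 0 ≤ f x)
    (hsup : ∀ x ∈ A, ∫ z, f (x + z) ∂ν ≤ f x) (x : Z2) : 0 ≤ f x := by
  by_contra! hx
  have hxA : x ∈ A := by
    by_contra h
    exact absurd (hoff x h) (not_le.2 hx)
  obtain ⟨x₀, hx₀, hmin⟩ := Set.exists_min_image A f hA ⟨x, hxA⟩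
  have hneg : f x₀ < 0 := (hmin x hxA).trans_lt hx
  have hmin' : ∀ u, f x₀ ≤ f u := fun u => by
    by_cases hu : u ∈ A
    · exact hmin u hu
    · exact hneg.le.trans (hoff u hu)
  -- A negative minimum is attained inside `A`. There the average is squeezed to the minimal value,
  -- so the minimum is also attained after the step `z₀`.
  obtain ⟨z₀, hz₀, hz₀'⟩ := hν.exists_ne_zero
  have step : ∀ u ∈ A, f u = f x₀ → f (u + z₀) = f x₀ := by
    intro u hu hfu
    have hint : Integrable (fun z => f (u + z) - f x₀) ν := (hi u hu).sub (integrable_const _)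
    have hle : ∫ z, (f (u + z) - f x₀) ∂ν ≤ 0 := by
      rw [integral_sub (hi u hu) (integrable_const _)]
      simpa [hfu] using hsup u hu
    have h0 : ∫ z, (f (u + z) - f x₀) ∂ν = 0 :=
      le_antisymm hle (integral_nonneg fun z => sub_nonneg.2 (hmin' _))
    have hae := (integral_eq_zero_iff_of_nonneg (fun z => sub_nonneg.2 (hmin' _)) hint).1 h0
    have := (ae_iff_of_countable.1 hae) z₀ hz₀'
    exact sub_eq_zero.1 this
  -- Iterating produces infinitely many points on a ray; all lie in `A` because `f` is negative at
  -- them, which contradicts finiteness.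
  have iter : ∀ k : ℕ, x₀ + k • z₀ ∈ A ∧ f (x₀ + k • z₀) = f x₀ := by
    intro k
    induction k with
    | zero => simpa using hx₀
    | succ k ih =>
      have h := step _ ih.1 ih.2
      rw [succ_nsmul, ← add_assoc]
      refine ⟨?_, h⟩
      by_contra hn
      exact absurd (hoff _ hn) (by rw [h]; exact not_le.2 hneg)
  refine Set.infinite_of_injective_forall_mem (f := fun k : ℕ => x₀ + k • z₀) ?_
    (fun k => (iter k).1) hA
  intro a b hab
  obtain ⟨i, hi'⟩ : ∃ i, z₀ i ≠ 0 := Function.ne_iff.1 hz₀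
  have := congrFun (add_left_cancel hab) i
  simpa [hi'] using this

end StepLaw

/-! ### Green's functions of finite sets -/

/-- `g` is the Green's function with pole `y` of the walk with step law `ν` killed on leaving
`A`. -/
structure IsGreen (ν : Measure Z2) (A : Set Z2) (y : Z2) (g : Z2 → ℝ) : Prop where
  nonneg : ∀ x, 0 ≤ g x
  off : ∀ x ∉ A, g x = 0
  eq : ∀ x ∈ A, g x = (if x = y then 1 else 0) + ∫ z, g (x + z) ∂ν

namespace IsGreen

variable {ν : Measure Z2} {A : Set Z2}

lemma integral_le {y : Z2} {g : Z2 → ℝ} (hg : IsGreen ν A y g) {x : Z2} (hx : x ∈ A) :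
    ∫ z, g (x + z) ∂ν ≤ g x := by
  rw [hg.eq x hx]
  split_ifs <;> simp

variable [IsProbabilityMeasure ν]

lemma integrable {y : Z2} {g : Z2 → ℝ} (hg : IsGreen ν A y g) (hA : A.Finite) (x : Z2) :
    Integrable (fun z => g (x + z)) ν :=
  StepLaw.integrable_of_finite_support hA hg.off x

lemma integral_eq_sum {f : Z2 → ℝ} (hA : A.Finite) (hf : ∀ x ∉ A, f x = 0) (w : Z2) :
    ∫ z, f (w + z) ∂ν = ∑ u ∈ hA.toFinset, f u * ν.real {u - w} := by
  rw [integral_countable (StepLaw.integrable_of_finite_support hA hf w),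
    ← (Equiv.subRight w).tsum_eq, tsum_eq_sum (s := hA.toFinset)]
  · refine Finset.sum_congr rfl fun u _ => ?_
    simp [mul_comm]
  · intro u hu
    simp [hf u (by simpa using hu)]

/-- The Green's function is symmetric. -/
lemma symm (hν : StepLaw ν) (hA : A.Finite) {x y : Z2} {g h : Z2 → ℝ} (hx : x ∈ A) (hy : y ∈ A)
    (hg : IsGreen ν A y g) (hh : IsGreen ν A x h) : g x = h y := by
  -- Pairing the first-step equation with a second function isolates its value at the pole. The
  -- remaining quadratic form is symmetric, because the step law is.
  have key : ∀ {a : Z2} {p q : Z2 → ℝ}, a ∈ A → IsGreen ν A a p →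
      ∑ w ∈ hA.toFinset, q w * p w
        = q a + ∑ w ∈ hA.toFinset, ∑ u ∈ hA.toFinset, q w * p u * ν.real {u - w} := by
    intro a p q ha hp
    have h1 : ∀ w ∈ hA.toFinset, q w * p w
        = (if w = a then q w else 0) + ∑ u ∈ hA.toFinset, q w * p u * ν.real {u - w} := by
      intro w hw
      conv_lhs => rw [hp.eq w (by simpa using hw), integral_eq_sum hA hp.off w]
      rw [mul_add, Finset.mul_sum]
      simp [mul_assoc]
    rw [Finset.sum_congr rfl h1, Finset.sum_add_distrib]
    simp [ha]
  have e1 := key (q := h) hy hg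
  have e2 := key (q := g) hx hh
  have e3 : ∑ w ∈ hA.toFinset, ∑ u ∈ hA.toFinset, h w * g u * ν.real {u - w}
      = ∑ w ∈ hA.toFinset, ∑ u ∈ hA.toFinset, g w * h u * ν.real {u - w} := by
    rw [Finset.sum_comm]
    refine Finset.sum_congr rfl fun w _ => Finset.sum_congr rfl fun u _ => ?_
    rw [mul_comm (h u), measureReal_def, ← neg_sub, hν.neg, ← measureReal_def]
  have e4 : ∑ w ∈ hA.toFinset, h w * g w = ∑ w ∈ hA.toFinset, g w * h w :=
    Finset.sum_congr rfl fun w _ => mul_comm _ _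
  linarith

end IsGreen

/-! ### A local Harnack inequality -/

namespace StepLaw

variable {ν : Measure Z2}

/-- Nonnegative functions superharmonic near `y` satisfy `c * f (y + w) ≤ f y`. -/
def HarnackAt (ν : Measure Z2) (w : Z2) (c r : ℝ) : Prop :=
  ∀ (A : Set Z2) (y : Z2) (f : Z2 → ℝ), (∀ u, len (u - y) ≤ r → u ∈ A) → (∀ u, 0 ≤ f u) →
    (∀ u ∈ A, Integrable (fun z => f (u + z)) ν) → (∀ u ∈ A, ∫ z, f (u + z) ∂ν ≤ f u) →
    c * f (y + w) ≤ f y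

lemma harnackAt_step (w : Z2) : HarnackAt ν w (ν.real {w}) 0 := by
  intro A y f hA hf hi hs
  have hy : y ∈ A := hA y (by simp [len_zero])
  refine le_trans ?_ (hs y hy)
  refine le_trans ?_ (setIntegral_le_integral (s := {w}) (hi y hy) (ae_of_all _ fun z => hf _))
  simp [measureReal_def]

/-- Two inequalities are chained through `y + w`. The second is centred there, so its disk must be
enlarged by `|w|` to be measured from `y`. -/
lemma HarnackAt.add {w w' : Z2} {c c' r r' : ℝ} (hc : 0 ≤ c) (h : HarnackAt ν w c r)
    (h' : HarnackAt ν w' c' r') : HarnackAt ν (w + w') (c * c') (max r (r' + len w)) := by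
  intro A y f hA hf hi hs
  have h1 := h A y f (fun u hu => hA u (hu.trans (le_max_left _ _))) hf hi hs
  have h2 := h' A (y + w) f (fun u hu => hA u ?_) hf hi hs
  · rw [← add_assoc, mul_assoc]
    exact (mul_le_mul_of_nonneg_left h2 hc).trans h1
  · refine le_trans ?_ (le_max_right _ _)
    have : u - y = (u - (y + w)) + w := by abel
    rw [this]
    exact (len_add_le _ _).trans (by linarith)

variable [IsProbabilityMeasure ν]

/-- Every displacement is a finite sum of possible steps and their negatives, and each step costs a
positive factor. The induction carries `w` and `-w` together so that passing to inverses is a swap.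
-/
lemma exists_harnackAt (hν : StepLaw ν) (w : Z2) : ∃ c > 0, ∃ r, HarnackAt ν w c r := by
  have key : (∃ c > 0, ∃ r, HarnackAt ν w c r) ∧ ∃ c > 0, ∃ r, HarnackAt ν (-w) c r := by
    have hw : w ∈ AddSubgroup.closure {z | ν {z} ≠ 0} := by
      rw [hν.gen]
      trivial
    induction hw using AddSubgroup.closure_induction with
    | mem z hz =>
      refine ⟨⟨_, ?_, 0, harnackAt_step z⟩, ⟨_, ?_, 0, harnackAt_step (-z)⟩⟩
      · exact measureReal_nonneg.lt_of_ne' (by simpa [measureReal_eq_zero_iff] using hz)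
      · exact measureReal_nonneg.lt_of_ne' (by simpa [measureReal_eq_zero_iff, hν.neg] using hz)
    | zero =>
      have : HarnackAt ν 0 1 0 := fun A y f _ _ _ _ => by simp
      exact ⟨⟨1, one_pos, 0, this⟩, ⟨1, one_pos, 0, by simpa using this⟩⟩
    | add a b _ _ ha hb =>
      obtain ⟨⟨c, hc, r, h⟩, c', hc', r', h'⟩ := ha
      obtain ⟨⟨d, hd, q, k⟩, d', hd', q', k'⟩ := hb
      refine ⟨⟨_, mul_pos hc hd, _, h.add hc.le k⟩, ⟨_, mul_pos hc' hd', max r' (q' + len (-a)), ?_⟩⟩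
      rw [neg_add]
      exact h'.add hc'.le k'
    | neg a _ ha =>
      exact ⟨ha.2, by simpa using ha.1⟩
  exact key.1

/-- The local Harnack inequality, uniformly over a disk of fixed radius. -/
lemma exists_harnackAt_of_len_le (hν : StepLaw ν) (R : ℝ) :
    ∃ c > 0, ∃ r, ∀ w, len w < R → HarnackAt ν w c r := by
  choose c hc r hr using hν.exists_harnackAt
  obtain ⟨c₀, hc₀, hle⟩ : ∃ c₀ > 0, ∀ w ∈ disk 0 R, c₀ ≤ c w := by
    rcases (disk 0 R).eq_empty_or_nonempty with h | h
    · exact ⟨1, one_pos, by simp [h]⟩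
    · obtain ⟨w, hw, hmin⟩ := Set.exists_min_image _ c (finite_disk_zero R) h
      exact ⟨c w, hc w, hmin⟩
  obtain ⟨r₀, hr₀⟩ := ((finite_disk_zero R).image r).bddAbove
  refine ⟨c₀, hc₀, r₀, fun w hw A y f hA hf hi hs => ?_⟩
  have hw' : w ∈ disk 0 R := mem_disk_zero.2 hw
  refine (mul_le_mul_of_nonneg_right (hle w hw') (hf _)).trans ?_
  exact hr w A y f (fun u hu => hA u (hu.trans (hr₀ ⟨w, hw', rfl⟩))) hf hi hs

end StepLaw

/-! ### The step law of the walk -/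

section Walk

variable {Ω : Type*} [MeasurableSpace Ω] {μ : Measure Ω} [IsProbabilityMeasure μ]
  {β : ℝ} {ξ : ℕ → Ω → Z2}

lemma IsWalkSteps.map_neg (hξ : IsWalkSteps μ β ξ) (z : Z2) :
    μ.map (ξ 0) {-z} = μ.map (ξ 0) {z} := by
  rw [Measure.map_apply (hξ.measurable 0) (measurableSet_singleton _),
    Measure.map_apply (hξ.measurable 0) (measurableSet_singleton _)]
  exact (measureReal_eq_measureReal_iff).1 (hξ.symmetric z)

/-- Symmetry makes the mean zero, so covariances are second moments; generation is strong
aperiodicity with `t = 0`. -/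
lemma IsWalkSteps.stepLaw (hβ : 0 < β) (hξ : IsWalkSteps μ β ξ) : StepLaw (μ.map (ξ 0)) where
  neg := hξ.map_neg
  integrable_cube := by
    rw [integrable_map_measure (Measurable.of_discrete).aestronglyMeasurable
      (hξ.measurable 0).aemeasurable]
    refine hξ.moment.mono' ?_ (ae_of_all _ fun ω => ?_)
    · exact ((Measurable.of_discrete (f := fun z => len z ^ 3)).comp
        (hξ.measurable 0)).aestronglyMeasurable
    · rw [Function.comp_apply, Real.norm_eq_abs, abs_of_nonneg (pow_nonneg (len_nonneg _) 3)]
      -- Lattice lengths are zero or at least one, so the higher power dominates the cube pointwise.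
      rcases eq_or_ne (ξ 0 ω) 0 with h | h
      · simp only [h, len_zero]
        rw [Real.zero_rpow (by linarith)]
        norm_num
      · rw [← Real.rpow_natCast]
        refine Real.rpow_le_rpow_of_exponent_le (one_le_len h) ?_
        push_cast
        linarith
  second := by
    intro i j
    have hmean : ∀ k : Fin 2, ∫ ω, ((ξ 0 ω k : ℤ) : ℝ) ∂μ = 0 := by
      intro k
      have h := StepLaw.integral_neg_of_singleton hξ.map_neg (fun z => (z k : ℝ))
      simp only [Pi.neg_apply, Int.cast_neg, integral_neg] at h
      rw [integral_map (hξ.measurable 0).aemeasurable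
        (Measurable.of_discrete).aestronglyMeasurable] at h
      linarith
    rw [integral_map (hξ.measurable 0).aemeasurable
      (Measurable.of_discrete).aestronglyMeasurable, ← hξ.cov_eq i j, covariance]
    simp [hmean]
  gen := by
    rw [← hξ.aperiodic 0]
    congr 1
    ext z
    simp [stepProb, Measure.map_apply (hξ.measurable 0) (measurableSet_singleton z),
      measureReal_eq_zero_iff]
    rfl

/-- A finite supersolution dominates the Green's function of the walk, which is then a real-valued
Green's function of its step law. -/
lemma IsWalkSteps.exists_isGreen (hξ : IsWalkSteps μ β ξ) {A : Set Z2}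
    {y : Z2} (hy : y ∈ A) {U : Z2 → ℝ} (hU0 : ∀ w, 0 ≤ U w)
    (hUi : ∀ w ∈ A, Integrable (fun z => U (w + z)) (μ.map (ξ 0)))
    (hU : ∀ w ∈ A, (if w = y then 1 else 0) + ∫ z, U (w + z) ∂(μ.map (ξ 0)) ≤ U w) :
    ∃ g : Z2 → ℝ, IsGreen (μ.map (ξ 0)) A y g ∧ (∀ w, g w ≤ U w) ∧
      ∀ w, green μ ξ A y w = ENNReal.ofReal (g w) := by
  have hle : ∀ w, green μ ξ A y w ≤ ENNReal.ofReal (U w) := by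
    refine green_le_of_supersolution hξ.measurable hξ.indep hξ.identDistrib _ rfl hξ.map_neg hy
      (fun w => ENNReal.ofReal (U w)) fun w hw => ?_
    rw [← ofReal_integral_eq_lintegral_ofReal (hUi w hw) (ae_of_all _ fun z => hU0 _)]
    refine le_trans (le_of_eq ?_) (ENNReal.ofReal_le_ofReal (hU w hw))
    rw [ENNReal.ofReal_add (by split_ifs <;> simp) (integral_nonneg fun z => hU0 _)]
    split_ifs <;> simp
  have hfin : ∀ w, green μ ξ A y w ≠ ∞ := fun w => ne_top_of_le_ne_top ENNReal.ofReal_ne_top (hle w)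
  refine ⟨fun w => (green μ ξ A y w).toReal, ⟨fun w => ENNReal.toReal_nonneg, fun w hw => ?_,
    fun w hw => ?_⟩, fun w => ?_, fun w => (ENNReal.ofReal_toReal (hfin w)).symm⟩
  · simp [green_eq_zero μ ξ y hw]
  · have h := green_eq_add_lintegral hξ.measurable hξ.indep hξ.identDistrib _ rfl hξ.map_neg hy hw
    have hne : ∫⁻ z, green μ ξ A y (w + z) ∂(μ.map (ξ 0)) ≠ ∞ := by
      refine ne_top_of_le_ne_top (hfin w) ?_
      rw [h]
      exact le_add_self
    rw [h, ENNReal.toReal_add (by split_ifs <;> simp) hne, integral_toReal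
      (Measurable.of_discrete).aemeasurable (ae_of_all _ fun z => (hfin _).lt_top)]
    congr 1
    split_ifs <;> simp
  · exact (ENNReal.toReal_mono ENNReal.ofReal_ne_top (hle w)).trans
      (ENNReal.toReal_ofReal (hU0 w)).le

end Walk

/-! ### Taylor inequalities -/

lemma taylor_le_exp_neg (v : ℝ) : 1 - v + v ^ 2 / 2 - |v| ^ 3 ≤ Real.exp (-v) := by
  have h3 : |v| ^ 3 = |v| * v ^ 2 := by rw [pow_succ', sq_abs]
  rcases le_total |v| 1 with h | h
  · have := Real.exp_bound (x := -v) (by simpa using h) (n := 3) (by norm_num)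
    simp only [Finset.sum_range_succ, Finset.sum_range_zero, abs_neg] at this
    norm_num [Nat.factorial] at this
    have h' := (abs_le.1 this).1
    have h0 : 0 ≤ |v| ^ 3 := by positivity
    linarith
  · have h1 := Real.add_one_le_exp (-v)
    nlinarith [sq_nonneg v]

lemma abs_log_one_add_sub_le {v : ℝ} (hv : |v| ≤ 1 / 2) :
    |Real.log (1 + v) - (v - v ^ 2 / 2)| ≤ 2 * |v| ^ 3 := by
  have h := Real.abs_log_sub_add_sum_range_le (x := -v) (by rw [abs_neg]; linarith) 2
  simp only [Finset.sum_range_succ, Finset.sum_range_zero, abs_neg, sub_neg_eq_add] at h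
  have e : Real.log (1 + v) - (v - v ^ 2 / 2)
      = 0 + (-v) ^ (0 + 1) / ((0 : ℕ) + 1) + (-v) ^ (1 + 1) / ((1 : ℕ) + 1) + Real.log (1 + v) := by
    norm_num
    ring
  rw [e]
  refine h.trans ?_
  rw [div_le_iff₀ (by linarith)]
  have h0 : 0 ≤ |v| ^ 3 := by positivity
  norm_num
  nlinarith

section Increments

/-! In the next lemmas `p` and `q` are the scaled quantities `x·z / s` and `|z| / √s`, so that
`2 * p + q ^ 2` is the relative increment of the squared length. -/

variable {p q : ℝ}

lemma abs_increment_le (hp : |p| ≤ q) (hq : q ≤ 1) : |2 * p + q ^ 2| ≤ 3 * q := by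
  have h := abs_le.1 hp
  rw [abs_le]
  constructor <;> nlinarith

/-- For `q ≤ 1` this is Taylor's formula, with the cross terms of the squared increment moved into
`q³`; for `q ≥ 1` convexity suffices, as `q² ≤ q³`. -/
lemma taylor_le_exp_increment {l : ℝ} (hl : 0 ≤ l) (hp : |p| ≤ q) :
    1 - l * (2 * p + q ^ 2) + 2 * l ^ 2 * p ^ 2 - (2 * l ^ 2 + 27 * l ^ 3) * q ^ 3
      ≤ Real.exp (-(l * (2 * p + q ^ 2))) := by
  have hq0 : 0 ≤ q := (abs_nonneg p).trans hp
  have h := abs_le.1 hp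
  have hpq : p ^ 2 ≤ q ^ 2 := sq_le_sq' h.1 h.2
  have hq3 : 0 ≤ q ^ 3 := by positivity
  rcases le_total q 1 with hq | hq
  · have h1 := taylor_le_exp_neg (l * (2 * p + q ^ 2))
    have h2 : |l * (2 * p + q ^ 2)| ^ 3 ≤ 27 * l ^ 3 * q ^ 3 := by
      rw [abs_mul, abs_of_nonneg hl, mul_pow]
      have := pow_le_pow_left₀ (abs_nonneg _) (abs_increment_le hp hq) 3
      have := mul_le_mul_of_nonneg_left this (pow_nonneg hl 3)
      nlinarith
    have h3 : 2 * l ^ 2 * p ^ 2 - 2 * l ^ 2 * q ^ 3 ≤ (l * (2 * p + q ^ 2)) ^ 2 / 2 := by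
      have : 0 ≤ l ^ 2 * (2 * q ^ 2 * (p + q) + q ^ 4 / 2) := by
        have : 0 ≤ p + q := by linarith
        positivity
      nlinarith
    linarith
  · have h1 := Real.add_one_le_exp (-(l * (2 * p + q ^ 2)))
    have h2 : q ^ 2 ≤ q ^ 3 := pow_le_pow_right₀ hq (by norm_num)
    have h3 : l ^ 2 * p ^ 2 ≤ l ^ 2 * q ^ 3 :=
      mul_le_mul_of_nonneg_left (hpq.trans h2) (sq_nonneg l)
    have h4 : 0 ≤ l ^ 3 * q ^ 3 := by positivity
    linarith

lemma abs_log_increment_sub_le (hp : |p| ≤ q) (hq : q ≤ 1 / 6) :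
    |Real.log (1 + (2 * p + q ^ 2)) - (2 * p + q ^ 2 - 2 * p ^ 2)| ≤ 57 * q ^ 3 := by
  have hq0 : 0 ≤ q := (abs_nonneg p).trans hp
  have h := abs_le.1 hp
  have hv := abs_increment_le hp (by linarith)
  have h1 := abs_log_one_add_sub_le (v := 2 * p + q ^ 2) (hv.trans (by linarith))
  have h2 : |2 * p + q ^ 2| ^ 3 ≤ 27 * q ^ 3 := by
    refine (pow_le_pow_left₀ (abs_nonneg _) hv 3).trans_eq ?_
    ring
  have h3 : |(2 * p + q ^ 2 - (2 * p + q ^ 2) ^ 2 / 2) - (2 * p + q ^ 2 - 2 * p ^ 2)|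
      ≤ 3 * q ^ 3 := by
    have e : (2 * p + q ^ 2 - (2 * p + q ^ 2) ^ 2 / 2) - (2 * p + q ^ 2 - 2 * p ^ 2)
        = -(q ^ 2 * (2 * p + q ^ 2 / 2)) := by ring
    rw [e, abs_neg, abs_mul, abs_of_nonneg (sq_nonneg q)]
    have : |2 * p + q ^ 2 / 2| ≤ 3 * q := by
      rw [abs_le]
      constructor <;> nlinarith
    nlinarith [mul_le_mul_of_nonneg_left this (sq_nonneg q)]
  have h4 := abs_sub_le (Real.log (1 + (2 * p + q ^ 2)))
    (2 * p + q ^ 2 - (2 * p + q ^ 2) ^ 2 / 2) (2 * p + q ^ 2 - 2 * p ^ 2)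
  linarith

/-- For long jumps every lower power of `q` is absorbed by `q³`, so crude bounds are enough there.
-/
lemma one_le_of_sixth_le (hq : 1 / 6 ≤ q) : 1 ≤ 216 * q ^ 3 ∧ q ≤ 36 * q ^ 3 ∧ q ^ 2 ≤ 6 * q ^ 3 := by
  have h1 : q ^ 2 ≤ 6 * q ^ 3 := by nlinarith [sq_nonneg q]
  have h2 : q ≤ 6 * q ^ 2 := by nlinarith
  exact ⟨by nlinarith, by nlinarith, h1⟩

lemma log_increment_le (hp : |p| ≤ q) (hpos : 0 < 1 + (2 * p + q ^ 2)) :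
    Real.log (1 + (2 * p + q ^ 2)) ≤ 2 * p + q ^ 2 - 2 * p ^ 2 + 57 * q ^ 3 := by
  rcases le_total q (1 / 6) with hq | hq
  · have := (abs_le.1 (abs_log_increment_sub_le hp hq)).2
    linarith
  · obtain ⟨h1, h2, h3⟩ := one_le_of_sixth_le hq
    have := Real.log_le_sub_one_of_pos hpos
    have hpq : p ^ 2 ≤ q ^ 2 := sq_le_sq' (abs_le.1 hp).1 (abs_le.1 hp).2
    linarith

/-- The logarithm can drop by as much as `log s` when a long jump lands near the origin, which puts
the factor `1 + log s` in front of the cubic error. -/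
lemma le_log_increment {s : ℝ} (hs : 1 ≤ s) (hp : |p| ≤ q) (hpos : 1 / s ≤ 1 + (2 * p + q ^ 2)) :
    2 * p + q ^ 2 - 2 * p ^ 2 - 216 * (1 + Real.log s) * q ^ 3
      ≤ Real.log (1 + (2 * p + q ^ 2)) := by
  have hq0 : 0 ≤ q := (abs_nonneg p).trans hp
  have hlog := Real.log_nonneg hs
  have hq3 : 0 ≤ q ^ 3 := by positivity
  rcases le_total q (1 / 6) with hq | hq
  · have := (abs_le.1 (abs_log_increment_sub_le hp hq)).1
    nlinarith [mul_nonneg hlog hq3]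
  · obtain ⟨h1, h2, h3⟩ := one_le_of_sixth_le hq
    have hl := Real.log_le_log (by positivity) hpos
    rw [one_div, Real.log_inv] at hl
    have hpq := (abs_le.1 hp).2
    nlinarith [mul_le_mul_of_nonneg_left h1 hlog, sq_nonneg p]

/-- This expands the power `-1/4` of the relative increment. The surplus `p²/8` is what makes the
correction term strictly subharmonic at large distance. -/
lemma taylor_le_exp_log_increment (hp : |p| ≤ q) (hpos : 0 < 1 + (2 * p + q ^ 2)) :
    1 - (2 * p + q ^ 2 - 2 * p ^ 2) / 4 + p ^ 2 / 8 - 300 * q ^ 3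
      ≤ Real.exp (-(Real.log (1 + (2 * p + q ^ 2)) / 4)) := by
  have hq0 : 0 ≤ q := (abs_nonneg p).trans hp
  have hpq : p ^ 2 ≤ q ^ 2 := sq_le_sq' (abs_le.1 hp).1 (abs_le.1 hp).2
  have hq3 : 0 ≤ q ^ 3 := by positivity
  rcases le_total q (1 / 6) with hq | hq
  · set l := Real.log (1 + (2 * p + q ^ 2)) with hl
    have h1 := abs_log_increment_sub_le hp hq
    rw [← hl] at h1
    have h2 := taylor_le_exp_neg (l / 4)
    have hq2 : q ^ 3 ≤ q ^ 2 / 6 := by nlinarith [sq_nonneg q]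
    have hqq : q ^ 2 ≤ q / 6 := by nlinarith
    obtain ⟨h1a, h1b⟩ := abs_le.1 h1
    obtain ⟨hpa, hpb⟩ := abs_le.1 hp
    have hd : |l - 2 * p| ≤ 13 * q ^ 2 := by
      rw [abs_le]
      constructor <;> nlinarith [sq_nonneg p]
    obtain ⟨hda, hdb⟩ := abs_le.1 hd
    have hs : |l + 2 * p| ≤ 7 * q := by
      rw [abs_le]
      constructor <;> linarith
    have hl2 : 4 * p ^ 2 - 91 * q ^ 3 ≤ l ^ 2 := by
      have h := mul_le_mul hd hs (abs_nonneg _) (by positivity)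
      rw [← abs_mul] at h
      have := (abs_le.1 h).1
      nlinarith
    have hl3 : |l / 4| ^ 3 ≤ 8 * q ^ 3 := by
      have : |l / 4| ≤ 2 * q := by
        rw [abs_le]
        constructor <;> linarith
      exact (pow_le_pow_left₀ (abs_nonneg _) this 3).trans_eq (by ring)
    nlinarith
  · obtain ⟨h1, h2, h3⟩ := one_le_of_sixth_le hq
    have := Real.exp_pos (-(Real.log (1 + (2 * p + q ^ 2)) / 4))
    have hpa := (abs_le.1 hp).1
    nlinarith

end Increments

/-! ### The exponential barrier -/

namespace StepLaw

variable {ν : Measure Z2} [IsProbabilityMeasure ν]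

lemma abs_dot_div_le {x z : Z2} {σ : ℝ} (hσ : 0 < σ) (hx : len x ≤ σ) :
    |dot x z / σ ^ 2| ≤ len z / σ := by
  rw [abs_div, abs_of_pos (by positivity : 0 < σ ^ 2), div_le_div_iff₀ (by positivity) hσ]
  have := (abs_dot_le x z).trans (mul_le_mul_of_nonneg_right hx (len_nonneg z))
  nlinarith

/-- The function `exp (l (1 - |x|² / n²))` is subharmonic away from the origin. -/
lemma exp_barrier (hν : StepLaw ν) {l s : ℝ} (hl : 0 < l) (hs0 : 0 ≤ s)
    (hs : 1 < l * s ^ 2) :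
    ∀ᶠ n : ℝ in atTop, ∀ x, s * n ≤ len x → len x ≤ n →
      Integrable (fun z => Real.exp (l * (1 - len (x + z) ^ 2 / n ^ 2))) ν ∧
      Real.exp (l * (1 - len x ^ 2 / n ^ 2))
        ≤ ∫ z, Real.exp (l * (1 - len (x + z) ^ 2 / n ^ 2)) ∂ν := by
  set C := (2 * l ^ 2 + 27 * l ^ 3) * cubeMoment ν with hC
  -- The relative second-order drift is at least this constant over `n²`, while the cubic error is
  -- `C / n³`; this dictates the threshold on `n`.
  have hκ : 0 < 2 * l * (l * s ^ 2 - 1) := mul_pos (by linarith) (by linarith)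
  filter_upwards [eventually_gt_atTop 0, eventually_ge_atTop (C / (2 * l * (l * s ^ 2 - 1)))]
    with n hn hnC x hx hxn
  have hint : Integrable (fun z => Real.exp (l * (1 - len (x + z) ^ 2 / n ^ 2))) ν := by
    refine hν.integrable_of_abs_le (a := Real.exp l) (b := 0) fun z => ?_
    rw [abs_of_pos (Real.exp_pos _), zero_mul, add_zero, Real.exp_le_exp]
    have : 0 ≤ len (x + z) ^ 2 / n ^ 2 := by positivity
    nlinarith
  refine ⟨hint, ?_⟩
  set E := Real.exp (l * (1 - len x ^ 2 / n ^ 2)) with hE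
  have hE0 : 0 < E := Real.exp_pos _
  refine le_trans ?_ (hν.le_integral_of_taylorPoly_le hint x E (-(E * (2 * l / n ^ 2)))
    (-(E * (l / n ^ 2))) (E * (2 * l ^ 2 / n ^ 4)) (-(E * ((2 * l ^ 2 + 27 * l ^ 3) / n ^ 3)))
    fun z => ?_)
  · rw [div_le_iff₀ hκ] at hnC
    have h1 : s ^ 2 * n ^ 2 ≤ len x ^ 2 := by
      rw [← mul_pow]
      exact pow_le_pow_left₀ (by positivity) hx 2
    have h2 : 0 ≤ -2 * (l / n ^ 2) + 2 * l ^ 2 / n ^ 4 * len x ^ 2 - C / n ^ 3 := by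
      have e : -2 * (l / n ^ 2) + 2 * l ^ 2 / n ^ 4 * len x ^ 2 - C / n ^ 3
          = (-2 * l * n ^ 2 + 2 * l ^ 2 * len x ^ 2 - C * n) / n ^ 4 := by
        field_simp
      rw [e]
      refine div_nonneg ?_ (by positivity)
      nlinarith [mul_le_mul_of_nonneg_left h1 (sq_nonneg l), mul_le_mul_of_nonneg_right hnC hn.le]
    refine sub_nonneg.1 ((mul_nonneg hE0.le h2).trans_eq ?_)
    rw [hC]
    ring
  · have h := taylor_le_exp_increment hl.le (abs_dot_div_le (z := z) hn hxn)
    have e : Real.exp (l * (1 - len (x + z) ^ 2 / n ^ 2))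
        = E * Real.exp (-(l * (2 * (dot x z / n ^ 2) + (len z / n) ^ 2))) := by
      rw [hE, ← Real.exp_add, len_add_sq]
      congr 1
      ring
    rw [e]
    refine le_trans (le_of_eq ?_) (mul_le_mul_of_nonneg_left h hE0.le)
    field_simp
    ring

end StepLaw

/-! ### The boundary barrier -/

/-- A concave function on the half line, vanishing on the negative axis. -/
noncomputable def rootBarrier (t : ℝ) : ℝ := max t 0 + √(max t 0)

lemma rootBarrier_nonneg (t : ℝ) : 0 ≤ rootBarrier t :=
  add_nonneg (le_max_right _ _) (Real.sqrt_nonneg _)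

lemma rootBarrier_of_nonneg {t : ℝ} (ht : 0 ≤ t) : rootBarrier t = t + √t := by
  rw [rootBarrier, max_eq_left ht]

lemma rootBarrier_of_nonpos {t : ℝ} (ht : t ≤ 0) : rootBarrier t = 0 := by
  rw [rootBarrier, max_eq_right ht]
  simp

lemma rootBarrier_le {t : ℝ} (ht : 1 ≤ t) : rootBarrier t ≤ 2 * t := by
  rw [rootBarrier_of_nonneg (by linarith)]
  have : √t ≤ t := by
    rw [Real.sqrt_le_left (by linarith)]
    nlinarith
  linarith

lemma le_rootBarrier (t : ℝ) : t ≤ rootBarrier t :=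
  (le_max_left t 0).trans (le_add_of_nonneg_right (Real.sqrt_nonneg _))

lemma rootBarrier_mono {s t : ℝ} (h : s ≤ t) : rootBarrier s ≤ rootBarrier t :=
  add_le_add (max_le_max_right 0 h) (Real.sqrt_le_sqrt (max_le_max_right 0 h))

/-- After scaling `u = r² w` this is `√(1 + w) ≤ 1 + w/2 - w²/16` on `[-1, 1]`: the square root
supplies the curvature that the linear part lacks. -/
lemma rootBarrier_add_le_of_abs_le {r u : ℝ} (hr : 1 ≤ r) (hu : |u| ≤ r ^ 2) :
    rootBarrier (r ^ 2 + u)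
      ≤ rootBarrier (r ^ 2) + (1 + 1 / (2 * r)) * u - u ^ 2 / (16 * r ^ 3) := by
  have hr0 : 0 < r := by linarith
  obtain ⟨h1, h2⟩ := abs_le.1 hu
  rw [rootBarrier_of_nonneg (by linarith), rootBarrier_of_nonneg (by positivity),
    Real.sqrt_sq hr0.le]
  obtain ⟨w, rfl⟩ : ∃ w, u = r ^ 2 * w := ⟨u / r ^ 2, by field_simp⟩
  have hw1 : -1 ≤ w := by
    by_contra! h
    nlinarith [sq_nonneg r, pow_pos hr0 2]
  have hw2 : w ≤ 1 := by
    by_contra! h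
    nlinarith [sq_nonneg r, pow_pos hr0 2]
  have e : (1 + 1 / (2 * r)) * (r ^ 2 * w) - (r ^ 2 * w) ^ 2 / (16 * r ^ 3)
      = r ^ 2 * w + r * (w / 2 - w ^ 2 / 16) := by
    field_simp
    ring
  have hs : √(r ^ 2 + r ^ 2 * w) ≤ r * (1 + w / 2 - w ^ 2 / 16) := by
    have h3 : 0 ≤ 1 + w / 2 - w ^ 2 / 16 := by nlinarith
    rw [Real.sqrt_le_left (by positivity), mul_pow]
    have : 1 + w ≤ (1 + w / 2 - w ^ 2 / 16) ^ 2 := by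
      have : 0 ≤ w ^ 2 * (2 - w) := by
        have : 0 ≤ 2 - w := by linarith
        positivity
      nlinarith [sq_nonneg (w ^ 2)]
    nlinarith [mul_le_mul_of_nonneg_left this (sq_nonneg r)]
  linarith

/-- A crude bound for jumps beyond the range of the quadratic estimate, including those across the
kink at zero. -/
lemma rootBarrier_add_le {r : ℝ} (hr : 1 ≤ r) (u : ℝ) :
    rootBarrier (r ^ 2 + u) ≤ rootBarrier (r ^ 2) + (1 + 1 / (2 * r)) * u + 2 * |u| := by
  have hr0 : 0 < r := by linarith
  have hi : 1 / (2 * r) ≤ 1 / 2 := by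
    rw [div_le_div_iff₀ (by positivity) (by norm_num)]
    linarith
  have hi0 : 0 < 1 / (2 * r) := by positivity
  rcases le_total |u| (r ^ 2) with h | h
  · refine (rootBarrier_add_le_of_abs_le hr h).trans ?_
    have : 0 ≤ u ^ 2 / (16 * r ^ 3) := by positivity
    linarith [abs_nonneg u]
  rcases le_total 0 u with hu | hu
  · rw [abs_of_nonneg hu] at h
    rw [rootBarrier_of_nonneg (by positivity), rootBarrier_of_nonneg (by positivity),
      Real.sqrt_sq hr0.le, abs_of_nonneg hu]
    have : √(r ^ 2 + u) ≤ r + 1 / (2 * r) * u := by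
      rw [Real.sqrt_le_left (by positivity)]
      have : (r + 1 / (2 * r) * u) ^ 2 = r ^ 2 + u + (1 / (2 * r) * u) ^ 2 := by
        field_simp
        ring
      rw [this]
      nlinarith [sq_nonneg (1 / (2 * r) * u)]
    linarith
  · rw [abs_of_nonpos hu] at h ⊢
    rw [rootBarrier_of_nonpos (by linarith)]
    have := rootBarrier_nonneg (r ^ 2)
    nlinarith

/-- One-step estimate for the boundary barrier: `d` and `q` stand for `x·z / n` and `|z|`. -/
lemma rootBarrier_step {r n d q : ℝ} (hr : 1 ≤ r) (hn : r ^ 2 ≤ 2 * n) (hd : |d| ≤ q) :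
    rootBarrier (r ^ 2 - (2 * d + q ^ 2 / n))
      ≤ rootBarrier (r ^ 2) - (1 + 1 / (2 * r)) * (2 * d + q ^ 2 / n) - d ^ 2 / (4 * r ^ 3)
        + 60 * q ^ 3 / r ^ 4 := by
  have hr0 : 0 < r := by linarith
  have hn0 : 0 < n := by nlinarith
  have hq0 : 0 ≤ q := (abs_nonneg d).trans hd
  have hq3 : 0 ≤ q ^ 3 := by positivity
  obtain ⟨hd1, hd2⟩ := abs_le.1 hd
  have hdq : d ^ 2 ≤ q ^ 2 := sq_le_sq' hd1 hd2
  set u := -(2 * d + q ^ 2 / n) with hu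
  have hr34 : r ^ 3 ≤ r ^ 4 := pow_le_pow_right₀ hr (by norm_num)
  have hr35 : r ^ 4 ≤ r ^ 5 := pow_le_pow_right₀ hr (by norm_num)
  have hqn : 0 ≤ q ^ 2 / n := by positivity
  have huq : |u| ≤ 2 * q + q ^ 2 / n := by
    rw [hu, abs_neg, abs_le]
    constructor <;> linarith
  have e1 : r ^ 2 - (2 * d + q ^ 2 / n) = r ^ 2 + u := by rw [hu]; ring
  have e2 : (1 + 1 / (2 * r)) * (2 * d + q ^ 2 / n) = -((1 + 1 / (2 * r)) * u) := by rw [hu]; ring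
  rw [e1, e2]
  rcases le_total |u| (r ^ 2) with h | h
  · refine (rootBarrier_add_le_of_abs_le hr h).trans ?_
    have key : d ^ 2 / (4 * r ^ 3) ≤ u ^ 2 / (16 * r ^ 3) + 60 * q ^ 3 / r ^ 4 := by
      have h1 : 4 * d ^ 2 - 8 * q ^ 3 / r ^ 2 ≤ u ^ 2 := by
        have h2 : q ^ 2 / n ≤ 2 * q ^ 2 / r ^ 2 := by
          rw [div_le_div_iff₀ hn0 (by positivity)]
          nlinarith [sq_nonneg q]
        have h3 : -(q * (2 * q ^ 2 / r ^ 2)) ≤ d * (q ^ 2 / n) := by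
          nlinarith
        have h4 : q * (2 * q ^ 2 / r ^ 2) = 2 * q ^ 3 / r ^ 2 := by ring
        have h5 : 8 * q ^ 3 / r ^ 2 = 4 * (2 * q ^ 3 / r ^ 2) := by ring
        have h6 : u ^ 2 = 4 * d ^ 2 + 4 * (d * (q ^ 2 / n)) + (q ^ 2 / n) ^ 2 := by
          rw [hu]; ring
        nlinarith [sq_nonneg (q ^ 2 / n)]
      have h7 : (4 * d ^ 2 - 8 * q ^ 3 / r ^ 2) / (16 * r ^ 3) ≤ u ^ 2 / (16 * r ^ 3) :=
        div_le_div_of_nonneg_right h1 (by positivity)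
      have h8 : (4 * d ^ 2 - 8 * q ^ 3 / r ^ 2) / (16 * r ^ 3)
          = d ^ 2 / (4 * r ^ 3) - q ^ 3 / (2 * r ^ 5) := by
        field_simp
        ring
      have h9 : q ^ 3 / (2 * r ^ 5) ≤ 60 * q ^ 3 / r ^ 4 := by
        rw [div_le_div_iff₀ (by positivity) (by positivity)]
        nlinarith [mul_le_mul_of_nonneg_left hr35 hq3, mul_nonneg hq3 (pow_pos hr0 5).le]
      linarith
    linarith
  -- Here the jump is long: `r² ≤ 3q` if `q ≤ n`, and `r² ≤ 2n ≤ 2q` otherwise, so all terms fit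
  -- into `q³ / r⁴`.
  · refine (rootBarrier_add_le hr u).trans ?_
    have h1 : 2 * |u| ≤ 54 * q ^ 3 / r ^ 4 := by
      rw [le_div_iff₀ (by positivity)]
      rcases le_total q n with hqn' | hqn'
      · have h2 : q ^ 2 / n ≤ q := by
          rw [div_le_iff₀ hn0]
          nlinarith
        have h3 : r ^ 2 ≤ 3 * q := by linarith
        have h4 : r ^ 4 ≤ 9 * q ^ 2 := by nlinarith [sq_nonneg r]
        have h5 : 2 * |u| ≤ 6 * q := by linarith
        have := mul_le_mul h5 h4 (by positivity) (by positivity)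
        linarith
      · have h2 : q ≤ q ^ 2 / n := by
          rw [le_div_iff₀ hn0]
          nlinarith
        have h3 : 2 * |u| ≤ 6 * (q ^ 2 / n) := by linarith
        have h4 : r ^ 4 ≤ 4 * n ^ 2 := by nlinarith [sq_nonneg r]
        have h5 := mul_le_mul h3 h4 (by positivity) (by positivity)
        have h6 : 6 * (q ^ 2 / n) * (4 * n ^ 2) = 24 * (q ^ 2 * n) := by
          field_simp
          ring
        nlinarith [sq_nonneg q]
    have h2 : d ^ 2 / (4 * r ^ 3) ≤ 6 * q ^ 3 / r ^ 4 := by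
      rw [div_le_div_iff₀ (by positivity) (by positivity)]
      rcases le_total q n with hqn' | hqn'
      · have h2 : q ^ 2 / n ≤ q := by
          rw [div_le_iff₀ hn0]
          nlinarith
        have h3 : r ≤ 3 * q := by nlinarith
        have h4 : d ^ 2 * r ≤ 3 * q ^ 3 := by nlinarith [mul_le_mul hdq h3 hr0.le (sq_nonneg q)]
        nlinarith [mul_le_mul_of_nonneg_left h4 (pow_pos hr0 3).le,
          mul_nonneg hq3 (pow_pos hr0 3).le]
      · have h3 : r ≤ 2 * q := by nlinarith
        have h4 : d ^ 2 * r ≤ 2 * q ^ 3 := by nlinarith [mul_le_mul hdq h3 hr0.le (sq_nonneg q)]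
        nlinarith [mul_le_mul_of_nonneg_left h4 (pow_pos hr0 3).le,
          mul_nonneg hq3 (pow_pos hr0 3).le]
    have h3 : 60 * q ^ 3 / r ^ 4 = 54 * q ^ 3 / r ^ 4 + 6 * q ^ 3 / r ^ 4 := by ring
    linarith

namespace StepLaw

variable {ν : Measure Z2} [IsProbabilityMeasure ν]

/-- The linear part has drift `-2/n` from `E|z|² = 2`. The shift `a` forces `r = √t` to be large, so
the gain of order `r⁻³` from concavity beats the error of order `r⁻⁴`, which includes overshoot past
the boundary. -/
lemma exists_boundary_barrier (hν : StepLaw ν) {η : ℝ} (hη : 0 < η) :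
    ∃ a ≥ 1, ∀ n ≥ a, ∀ x, η * n ≤ len x → len x ≤ n →
      Integrable (fun z => rootBarrier ((n ^ 2 - len (x + z) ^ 2) / n + a)) ν ∧
      ∫ z, rootBarrier ((n ^ 2 - len (x + z) ^ 2) / n + a) ∂ν
        ≤ rootBarrier ((n ^ 2 - len x ^ 2) / n + a) - 2 / n := by
  -- Chosen so that `r ≥ κ` and `|x| ≥ ηn` give `60 M / r⁴ ≤ |x|² / (4 r³ n²)`, where `M` is the
  -- third moment.
  set κ := 240 * cubeMoment ν / η ^ 2 with hκ
  have hκ0 : 0 ≤ κ := div_nonneg (mul_nonneg (by norm_num) (cubeMoment_nonneg ν)) (sq_nonneg η)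
  refine ⟨(1 + κ) ^ 2, by nlinarith, fun n hn x hx hxn => ?_⟩
  set a := (1 + κ) ^ 2 with ha
  have hn0 : 0 < n := lt_of_lt_of_le (by positivity) hn
  set t := (n ^ 2 - len x ^ 2) / n + a with ht
  have hx0 := len_nonneg x
  have hta : a ≤ t := by
    have : 0 ≤ (n ^ 2 - len x ^ 2) / n := div_nonneg (by nlinarith) hn0.le
    linarith
  have htn : t ≤ 2 * n := by
    have : (n ^ 2 - len x ^ 2) / n ≤ n := by
      rw [div_le_iff₀ hn0]
      nlinarith
    linarith
  set r := √t with hr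
  have ht0 : 0 ≤ t := le_trans (by positivity) hta
  have hr2 : r ^ 2 = t := Real.sq_sqrt ht0
  have hrκ : 1 + κ ≤ r := Real.le_sqrt_of_sq_le hta
  have hr1 : 1 ≤ r := by linarith
  have hr0 : 0 < r := by linarith
  have hint : Integrable (fun z => rootBarrier ((n ^ 2 - len (x + z) ^ 2) / n + a)) ν := by
    refine hν.integrable_of_abs_le (a := rootBarrier (n + a)) (b := 0) fun z => ?_
    rw [abs_of_nonneg (rootBarrier_nonneg _), zero_mul, add_zero]
    refine rootBarrier_mono (add_le_add_left ?_ a)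
    rw [div_le_iff₀ hn0]
    nlinarith [sq_nonneg (len (x + z))]
  refine ⟨hint, ?_⟩
  refine (hν.integral_le_of_le_taylorPoly hint x (rootBarrier t) (-((1 + 1 / (2 * r)) * (2 / n)))
    (-((1 + 1 / (2 * r)) * (1 / n))) (-(1 / (4 * r ^ 3 * n ^ 2))) (60 / r ^ 4)
    fun z => ?_).trans ?_
  · have hd : |dot x z / n| ≤ len z := by
      rw [abs_div, abs_of_pos hn0, div_le_iff₀ hn0, mul_comm]
      exact (abs_dot_le x z).trans (mul_le_mul_of_nonneg_right hxn (len_nonneg z))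
    have h := rootBarrier_step (n := n) hr1 (hr2.le.trans htn) hd
    rw [hr2] at h
    have e : (n ^ 2 - len (x + z) ^ 2) / n + a = t - (2 * (dot x z / n) + len z ^ 2 / n) := by
      rw [ht, len_add_sq]
      ring
    rw [e]
    refine h.trans_eq ?_
    ring
  · have h1 : 60 / r ^ 4 * cubeMoment ν ≤ 1 / (4 * r ^ 3 * n ^ 2) * len x ^ 2 := by
      have h2 : η ^ 2 * n ^ 2 ≤ len x ^ 2 := by
        rw [← mul_pow]
        exact pow_le_pow_left₀ (by positivity) hx 2
      have h3 : 240 * cubeMoment ν ≤ r * η ^ 2 := by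
        have : κ ≤ r := by linarith
        rwa [hκ, div_le_iff₀ (by positivity)] at this
      rw [div_mul_eq_mul_div, div_mul_eq_mul_div, div_le_div_iff₀ (by positivity) (by positivity)]
      have h4 : 240 * cubeMoment ν * n ^ 2 ≤ r * len x ^ 2 := by
        nlinarith [mul_le_mul_of_nonneg_right h3 (sq_nonneg n), mul_le_mul_of_nonneg_left h2 hr0.le]
      nlinarith [mul_le_mul_of_nonneg_left h4 (pow_pos hr0 3).le]
    have h5 : 0 ≤ 1 / (2 * r) * (1 / n) := by positivity
    have h6 : 2 / n = 2 * (1 / n) := by ring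
    rw [h6]
    nlinarith

end StepLaw

/-! ### Logarithmic barriers -/

/-- The regularised logarithm `log (|x|² + R²)`. -/
noncomputable def regLog (R : ℝ) (x : Z2) : ℝ := Real.log (len x ^ 2 + R ^ 2)

section RegLog

variable {R : ℝ}

lemma one_le_len_sq_add (hR : 1 ≤ R) (x : Z2) : 1 ≤ len x ^ 2 + R ^ 2 := by
  nlinarith [sq_nonneg (len x)]

lemma regLog_nonneg (hR : 1 ≤ R) (x : Z2) : 0 ≤ regLog R x :=
  Real.log_nonneg (one_le_len_sq_add hR x)

lemma regLog_add (hR : 1 ≤ R) (x z : Z2) :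
    0 < 1 + (2 * (dot x z / √(len x ^ 2 + R ^ 2) ^ 2) + (len z / √(len x ^ 2 + R ^ 2)) ^ 2) ∧
    1 / (len x ^ 2 + R ^ 2)
      ≤ 1 + (2 * (dot x z / √(len x ^ 2 + R ^ 2) ^ 2) + (len z / √(len x ^ 2 + R ^ 2)) ^ 2) ∧
    regLog R (x + z) = regLog R x + Real.log
      (1 + (2 * (dot x z / √(len x ^ 2 + R ^ 2) ^ 2) + (len z / √(len x ^ 2 + R ^ 2)) ^ 2)) := by
  have hs := one_le_len_sq_add hR x
  have hs' := one_le_len_sq_add hR (x + z)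
  have hs0 : 0 < len x ^ 2 + R ^ 2 := by linarith
  have e : 1 + (2 * (dot x z / √(len x ^ 2 + R ^ 2) ^ 2) + (len z / √(len x ^ 2 + R ^ 2)) ^ 2)
      = (len (x + z) ^ 2 + R ^ 2) / (len x ^ 2 + R ^ 2) := by
    rw [div_pow, Real.sq_sqrt hs0.le, len_add_sq]
    field_simp
    ring
  rw [e]
  refine ⟨by positivity, div_le_div_of_nonneg_right hs' hs0.le, ?_⟩
  rw [Real.log_div (by positivity) hs0.ne', regLog, regLog]
  ring

lemma abs_dot_div_sqrt_le (hR : 1 ≤ R) (x z : Z2) :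
    |dot x z / √(len x ^ 2 + R ^ 2) ^ 2| ≤ len z / √(len x ^ 2 + R ^ 2) :=
  StepLaw.abs_dot_div_le (Real.sqrt_pos.2 (by linarith [one_le_len_sq_add hR x]))
    (Real.le_sqrt_of_sq_le (by nlinarith))

end RegLog

namespace StepLaw

variable {ν : Measure Z2} [IsProbabilityMeasure ν] {R : ℝ}

lemma integrable_regLog (hν : StepLaw ν) (hR : 1 ≤ R) (x : Z2) :
    Integrable (fun z => regLog R (x + z)) ν := by
  refine (((integrable_const (2 * len x ^ 2 + R ^ 2)).add
    (hν.integrable_len_sq.const_mul 2))).mono' (Measurable.of_discrete).aestronglyMeasurable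
    (ae_of_all _ fun z => ?_)
  rw [Real.norm_eq_abs, abs_of_nonneg (regLog_nonneg hR _)]
  have h1 := Real.log_le_sub_one_of_pos
    (by linarith [one_le_len_sq_add hR (x + z)] : 0 < len (x + z) ^ 2 + R ^ 2)
  have h2 : len (x + z) ^ 2 ≤ 2 * len x ^ 2 + 2 * len z ^ 2 := by
    have := pow_le_pow_left₀ (len_nonneg _) (len_add_le x z) 2
    nlinarith [sq_nonneg (len x - len z)]
  simp only [regLog, Pi.add_apply]
  linarith

lemma integrable_exp_regLog (hν : StepLaw ν) (hR : 1 ≤ R) (x : Z2) :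
    Integrable (fun z => Real.exp (-(regLog R (x + z) / 4))) ν := by
  refine hν.integrable_of_abs_le (a := 1) (b := 0) fun z => ?_
  rw [abs_of_pos (Real.exp_pos _), zero_mul, add_zero, Real.exp_le_one_iff]
  linarith [regLog_nonneg hR (x + z)]

/-- The drift of the regularised logarithm, up to third-order terms. -/
lemma integral_regLog_le (hν : StepLaw ν) (hR : 1 ≤ R) (x : Z2) :
    ∫ z, regLog R (x + z) ∂ν ≤ regLog R x + 2 * R ^ 2 / (len x ^ 2 + R ^ 2) ^ 2
      + 57 * cubeMoment ν / √(len x ^ 2 + R ^ 2) ^ 3 := by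
  set σ := √(len x ^ 2 + R ^ 2) with hσ
  have hσ0 : 0 < σ := Real.sqrt_pos.2 (by linarith [one_le_len_sq_add hR x])
  have hσ2 : len x ^ 2 + R ^ 2 = σ ^ 2 :=
    (Real.sq_sqrt (by linarith [one_le_len_sq_add hR x])).symm
  refine (hν.integral_le_of_le_taylorPoly (hν.integrable_regLog hR x) x (regLog R x) (2 / σ ^ 2)
    (1 / σ ^ 2) (-(2 / σ ^ 4)) (57 / σ ^ 3) fun z => ?_).trans_eq ?_
  · obtain ⟨h1, -, h3⟩ := regLog_add hR x z
    rw [← hσ] at h1 h3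
    rw [h3]
    have := log_increment_le (abs_dot_div_sqrt_le hR x z) h1
    rw [← hσ] at this
    refine (add_le_add_right this _).trans_eq ?_
    field_simp
    ring
  · have hx : len x ^ 2 = σ ^ 2 - R ^ 2 := by linarith
    rw [hσ2, hx]
    field_simp
    ring

lemma le_integral_regLog (hν : StepLaw ν) (hR : 1 ≤ R) (x : Z2) :
    regLog R x + 2 * R ^ 2 / (len x ^ 2 + R ^ 2) ^ 2
      - 216 * (1 + regLog R x) * cubeMoment ν / √(len x ^ 2 + R ^ 2) ^ 3
      ≤ ∫ z, regLog R (x + z) ∂ν := by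
  set σ := √(len x ^ 2 + R ^ 2) with hσ
  have hσ0 : 0 < σ := Real.sqrt_pos.2 (by linarith [one_le_len_sq_add hR x])
  have hσ2 : len x ^ 2 + R ^ 2 = σ ^ 2 :=
    (Real.sq_sqrt (by linarith [one_le_len_sq_add hR x])).symm
  refine le_trans (le_of_eq ?_) (hν.le_integral_of_taylorPoly_le (hν.integrable_regLog hR x) x
    (regLog R x) (2 / σ ^ 2) (1 / σ ^ 2) (-(2 / σ ^ 4)) (-(216 * (1 + regLog R x) / σ ^ 3))
    fun z => ?_)
  · have hx : len x ^ 2 = σ ^ 2 - R ^ 2 := by linarith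
    rw [hσ2, hx]
    field_simp
    ring
  · obtain ⟨-, h2, h3⟩ := regLog_add hR x z
    rw [h3]
    have := le_log_increment (one_le_len_sq_add hR x) (abs_dot_div_sqrt_le hR x z) h2
    rw [← regLog, ← hσ] at this
    rw [← hσ]
    refine le_trans (le_of_eq ?_) (add_le_add_right this _)
    field_simp
    ring

/-- With `σ² = |x|² + R²` the function is `σ^(-1/2)`, whose leading drift `σ^(-5/2) / 8` beats
errors of order `σ⁻³`, even with a logarithmic factor. It corrects the logarithm in both barriers
below. -/
lemma le_integral_exp_regLog (hν : StepLaw ν) (hR : 1 ≤ R) (x : Z2) :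
    Real.exp (-(regLog R x / 4)) * (1 + 1 / (8 * (len x ^ 2 + R ^ 2))
      - 5 * R ^ 2 / (8 * (len x ^ 2 + R ^ 2) ^ 2) - 300 * cubeMoment ν / √(len x ^ 2 + R ^ 2) ^ 3)
      ≤ ∫ z, Real.exp (-(regLog R (x + z) / 4)) ∂ν := by
  set σ := √(len x ^ 2 + R ^ 2) with hσ
  have hσ0 : 0 < σ := Real.sqrt_pos.2 (by linarith [one_le_len_sq_add hR x])
  have hσ2 : len x ^ 2 + R ^ 2 = σ ^ 2 :=
    (Real.sq_sqrt (by linarith [one_le_len_sq_add hR x])).symm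
  set E := Real.exp (-(regLog R x / 4)) with hE
  have hE0 : 0 < E := Real.exp_pos _
  refine le_trans (le_of_eq ?_) (hν.le_integral_of_taylorPoly_le (hν.integrable_exp_regLog hR x) x
    E (-(E / (2 * σ ^ 2))) (-(E / (4 * σ ^ 2))) (5 * E / (8 * σ ^ 4)) (-(300 * E / σ ^ 3))
    fun z => ?_)
  · have hx : len x ^ 2 = σ ^ 2 - R ^ 2 := by linarith
    rw [hσ2, hx]
    field_simp
    ring
  · obtain ⟨h1, -, h3⟩ := regLog_add hR x z
    rw [h3, add_div, neg_add, Real.exp_add]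
    have := taylor_le_exp_log_increment (abs_dot_div_sqrt_le hR x z) h1
    refine le_trans (le_of_eq ?_) (mul_le_mul_of_nonneg_left this hE0.le)
    rw [← hσ]
    field_simp
    ring

lemma eventually_affine_le_exp (a b : ℝ) : ∀ᶠ t : ℝ in atTop, a + b * t ≤ Real.exp (t / 4) := by
  filter_upwards [eventually_ge_atTop (32 * |a| + 32 * |b| + 1)] with t ht
  have ha := le_abs_self a
  have hb := le_abs_self b
  have ha0 := abs_nonneg a
  have hb0 := abs_nonneg b
  have h := Real.quadratic_le_exp_of_nonneg (x := t / 4) (by linarith)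
  nlinarith

/-- A third-order error is absorbed by the drift of the correction term. -/
lemma mul_inv_cube_le (hR : 1 ≤ R) (x : Z2) {a : ℝ} (h : 8 * a ≤ Real.exp (regLog R x / 4)) :
    a * (1 / √(len x ^ 2 + R ^ 2) ^ 3)
      ≤ Real.exp (-(regLog R x / 4)) * (1 / (8 * √(len x ^ 2 + R ^ 2) ^ 2)) := by
  have hs1 := one_le_len_sq_add hR x
  set σ := √(len x ^ 2 + R ^ 2) with hσ
  have hσ0 : 0 < σ := Real.sqrt_pos.2 (by linarith)
  have hsig : Real.exp (regLog R x / 4) ^ 2 = σ := by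
    rw [← Real.exp_nat_mul, ← Real.exp_log hσ0, hσ, Real.log_sqrt (by linarith), regLog]
    congr 1
    push_cast
    ring
  rw [Real.exp_neg]
  set e := Real.exp (regLog R x / 4)
  have he0 : 0 < e := Real.exp_pos _
  rw [← one_div, mul_one_div, one_div_mul_one_div,
    div_le_div_iff₀ (by positivity) (by positivity)]
  have h11 : a * 8 * e ≤ e * e := by nlinarith
  have h12 : σ ^ 3 = σ ^ 2 * (e * e) := by rw [← sq e, hsig]; ring
  rw [h12]
  nlinarith [mul_le_mul_of_nonneg_left h11 (sq_nonneg σ)]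

/-- A subharmonic function off a fixed disk, with a logarithmic singularity. -/
lemma exists_log_subharmonic (hν : StepLaw ν) :
    ∃ C > 0, ∃ r, ∀ x, regLog 1 x - Real.exp (-(regLog 1 x / 4))
      + C * (if len x < r then 1 else 0) ≥
      ∫ z, (regLog 1 (x + z) - Real.exp (-(regLog 1 (x + z) / 4))) ∂ν := by
  set M := cubeMoment ν with hM
  have hM0 : 0 ≤ M := cubeMoment_nonneg ν
  -- The constant `3 + 357 M` collects every error over `σ³`. Beyond `exp L₀` the correction absorbs
  -- it; inside, the indicator term does.
  obtain ⟨L₀, hL₀⟩ := (eventually_affine_le_exp (8 * (3 + 357 * M)) 0).exists_forall_of_atTop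
  refine ⟨3 + 357 * M, by positivity, Real.exp L₀, fun x => ?_⟩
  rw [integral_sub (hν.integrable_regLog le_rfl x) (hν.integrable_exp_regLog le_rfl x)]
  have h1 := hν.integral_regLog_le le_rfl x
  have h2 := hν.le_integral_exp_regLog le_rfl x
  set σ := √(len x ^ 2 + 1 ^ 2) with hσ
  have hs1 := one_le_len_sq_add le_rfl x
  have hσ1 : 1 ≤ σ := Real.one_le_sqrt.2 hs1
  have hσ0 : 0 < σ := by linarith
  have hσ2 : len x ^ 2 + 1 ^ 2 = σ ^ 2 := (Real.sq_sqrt (by linarith)).symm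
  set E := Real.exp (-(regLog 1 x / 4)) with hE
  have hE0 : 0 < E := Real.exp_pos _
  have hE1 : E ≤ 1 := by
    rw [hE, Real.exp_le_one_iff]
    linarith [regLog_nonneg le_rfl x]
  rw [hσ2, ← hM] at h1 h2
  have h34 : σ ^ 3 ≤ σ ^ 4 := pow_le_pow_right₀ hσ1 (by norm_num)
  have h3 : (1 : ℝ) / σ ^ 4 ≤ 1 / σ ^ 3 := one_div_le_one_div_of_le (by positivity) h34
  have h4 : 0 ≤ 1 / σ ^ 4 := by positivity
  have e1 : 2 * (1 : ℝ) ^ 2 / (σ ^ 2) ^ 2 = 2 * (1 / σ ^ 4) := by ring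
  have e2 : 5 * (1 : ℝ) ^ 2 / (8 * (σ ^ 2) ^ 2) = 5 / 8 * (1 / σ ^ 4) := by ring
  have e3 : 57 * M / σ ^ 3 = 57 * (M * (1 / σ ^ 3)) := by ring
  have e4 : 300 * M / σ ^ 3 = 300 * (M * (1 / σ ^ 3)) := by ring
  rw [e1, e3] at h1
  rw [e2, e4] at h2
  have hMσ : 0 ≤ M * (1 / σ ^ 3) := by positivity
  have main : regLog 1 x - E + (3 + 357 * M) * (1 / σ ^ 3) - E * (1 / (8 * σ ^ 2)) ≥
      ∫ z, regLog 1 (x + z) ∂ν - ∫ z, Real.exp (-(regLog 1 (x + z) / 4)) ∂ν := by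
    have h5 : E * (5 / 8 * (1 / σ ^ 4)) ≤ 5 / 8 * (1 / σ ^ 4) := mul_le_of_le_one_left (by positivity) hE1
    have h6 : E * (300 * (M * (1 / σ ^ 3))) ≤ 300 * (M * (1 / σ ^ 3)) :=
      mul_le_of_le_one_left (by positivity) hE1
    nlinarith
  have h7 : 0 ≤ E * (1 / (8 * σ ^ 2)) := by positivity
  have h8 : 1 / σ ^ 3 ≤ 1 := by
    rw [div_le_one (by positivity)]
    exact one_le_pow₀ hσ1
  split_ifs with hx
  · nlinarith
  · have hL : L₀ ≤ regLog 1 x := by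
      rw [regLog, Real.le_log_iff_exp_le (by linarith)]
      push Not at hx
      nlinarith [sq_nonneg (len x - 1)]
    have h9 := hL₀ _ hL
    have h10 := mul_inv_cube_le le_rfl x (a := 3 + 357 * M) (by linarith)
    rw [← hσ, ← hE] at h10
    linarith

/-! ### The logarithmic supersolution -/

/-- The truncated logarithmic potential at scale `n`. -/
noncomputable def _root_.logPotential (R n : ℝ) (x : Z2) : ℝ :=
  max (1 + Real.log (10 * n ^ 2) - regLog R x - Real.exp (-(regLog R x / 4))) 0

/-- Truncation matters only after jumps of order `n`. The constants `1` and `10` are chosen so that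
the untruncated value at `x + z` is at least `-|z|³ / n³`, even when `|x|` is as large as `2n`. -/
lemma integral_logPotential_le (hν : StepLaw ν) (hR : 1 ≤ R) {n : ℝ} (hn : R ≤ n) {x : Z2}
    (hx : len x ≤ 2 * n) :
    Integrable (fun z => logPotential R n (x + z)) ν ∧
    ∫ z, logPotential R n (x + z) ∂ν ≤ 1 + Real.log (10 * n ^ 2)
      - ∫ z, regLog R (x + z) ∂ν - ∫ z, Real.exp (-(regLog R (x + z) / 4)) ∂ν
      + cubeMoment ν / n ^ 3 := by
  have hn0 : 0 < n := by linarith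
  have h1 := hν.integrable_regLog hR x
  have h2 := hν.integrable_exp_regLog hR x
  have h0 : Integrable (fun z => 1 + Real.log (10 * n ^ 2) - regLog R (x + z)
      - Real.exp (-(regLog R (x + z) / 4))) ν := ((integrable_const _).sub h1).sub h2
  have hi : Integrable (fun z => logPotential R n (x + z)) ν := h0.sup (integrable_const 0)
  have h3 := hν.integrable_cube.div_const (n ^ 3)
  refine ⟨hi, ?_⟩
  have h01 : Integrable (fun z => 1 + Real.log (10 * n ^ 2) - regLog R (x + z)) ν :=
    (integrable_const _).sub h1
  have e : 1 + Real.log (10 * n ^ 2)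
      - ∫ z, regLog R (x + z) ∂ν - ∫ z, Real.exp (-(regLog R (x + z) / 4)) ∂ν
      + cubeMoment ν / n ^ 3
      = ∫ z, (1 + Real.log (10 * n ^ 2) - regLog R (x + z)
      - Real.exp (-(regLog R (x + z) / 4)) + len z ^ 3 / n ^ 3) ∂ν := by
    rw [integral_add h0 h3, integral_sub h01 h2, integral_sub (integrable_const _) h1,
      integral_div, cubeMoment]
    simp
  rw [e]
  refine integral_mono hi (h0.add h3) fun z => ?_
  have hz : 0 ≤ len z := len_nonneg z
  have hq : 0 ≤ len z ^ 3 / n ^ 3 := by positivity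
  refine max_le (by simpa using hq) ?_
  have hexp : Real.exp (-(regLog R (x + z) / 4)) ≤ 1 := by
    rw [Real.exp_le_one_iff]
    linarith [regLog_nonneg hR (x + z)]
  have hpos := one_le_len_sq_add hR (x + z)
  have hlog : regLog R (x + z) - Real.log (10 * n ^ 2) ≤ len z ^ 3 / n ^ 3 := by
    rw [regLog, ← Real.log_div (by linarith) (by positivity)]
    refine (Real.log_le_sub_one_of_pos (by positivity)).trans ?_
    have h4 : len (x + z) ^ 2 ≤ 8 * n ^ 2 + 2 * len z ^ 2 := by
      have := pow_le_pow_left₀ (len_nonneg _) (len_add_le x z) 2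
      have := pow_le_pow_left₀ (len_nonneg _) hx 2
      nlinarith [sq_nonneg (len x - len z)]
    have h5 : (len (x + z) ^ 2 + R ^ 2) / (10 * n ^ 2) ≤ 9 / 10 + (len z / n) ^ 2 / 5 := by
      rw [div_le_iff₀ (by positivity)]
      have : (9 / 10 + (len z / n) ^ 2 / 5) * (10 * n ^ 2) = 9 * n ^ 2 + 2 * len z ^ 2 := by
        field_simp
        ring
      rw [this]
      nlinarith
    rw [← div_pow]
    have hq0 : 0 ≤ len z / n := by positivity
    set q := len z / n
    rcases le_total q (1 / 2) with h | h
    · nlinarith [pow_nonneg hq0 3]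
    · nlinarith [sq_nonneg q]
  simp only
  linarith

/-- The rescaled logarithmic potential is a supersolution for the Green's function. -/
lemma exists_logPotential_supersolution (hν : StepLaw ν) :
    ∃ R ≥ 1, ∀ n ≥ R, ∀ x, len x ≤ 2 * n →
      Integrable (fun z => logPotential R n (x + z)) ν ∧
      (if x = 0 then 1 else 0) + R ^ 2 * ∫ z, logPotential R n (x + z) ∂ν
        ≤ R ^ 2 * logPotential R n x := by
  set M := cubeMoment ν with hM
  have hM0 : 0 ≤ M := cubeMoment_nonneg ν
  obtain ⟨L₀, hL₀⟩ :=
    (eventually_affine_le_exp (8 * (528 * M)) (8 * (216 * M))).exists_forall_of_atTop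
  -- A large regularisation makes `regLog R` exceed `L₀` everywhere, so the correction absorbs the
  -- cubic errors even at the pole.
  refine ⟨max 1 (Real.exp L₀), le_max_left _ _, fun n hn x hx => ?_⟩
  set R := max 1 (Real.exp L₀) with hRdef
  have hR : 1 ≤ R := le_max_left _ _
  obtain ⟨hi, hle⟩ := hν.integral_logPotential_le hR hn hx
  refine ⟨hi, ?_⟩
  have hn0 : 0 < n := by linarith
  have h1 := hν.le_integral_regLog hR x
  have h2 := hν.le_integral_exp_regLog hR x
  set σ := √(len x ^ 2 + R ^ 2) with hσ
  have hs1 := one_le_len_sq_add hR x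
  have hσ1 : 1 ≤ σ := Real.one_le_sqrt.2 hs1
  have hσ0 : 0 < σ := by linarith
  have hσ2 : len x ^ 2 + R ^ 2 = σ ^ 2 := (Real.sq_sqrt (by linarith)).symm
  set l := regLog R x with hl
  set E := Real.exp (-(l / 4)) with hE
  have hE0 : 0 < E := Real.exp_pos _
  have hl0 : 0 ≤ l := regLog_nonneg hR x
  have hE1 : E ≤ 1 := by
    rw [hE, Real.exp_le_one_iff]
    linarith
  rw [hσ2, ← hM] at h1 h2
  rw [← hM] at hle
  have hL : L₀ ≤ l := by
    rw [hl, regLog, Real.le_log_iff_exp_le (by linarith)]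
    have : Real.exp L₀ ≤ R := le_max_right _ _
    nlinarith [sq_nonneg (len x)]
  have h9 := hL₀ _ hL
  have h10 : (528 * M + 216 * M * l) * (1 / σ ^ 3) ≤ E * (1 / (8 * σ ^ 2)) :=
    mul_inv_cube_le hR x (by linarith)
  have h13 : M / n ^ 3 ≤ 12 * (M * (1 / σ ^ 3)) := by
    have h14 : σ ^ 2 ≤ 5 * n ^ 2 := by
      have h17 : len x ^ 2 ≤ 4 * n ^ 2 := by
        refine (pow_le_pow_left₀ (len_nonneg x) hx 2).trans_eq ?_
        ring
      have h18 : R ^ 2 ≤ n ^ 2 := pow_le_pow_left₀ (by linarith) hn 2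
      linarith
    have h15 : σ ≤ 12 / 5 * n := by
      refine le_of_sq_le_sq ?_ (by positivity)
      rw [mul_pow]
      linarith [sq_nonneg n]
    have h16 : σ ^ 3 ≤ 12 * n ^ 3 := by
      have h := mul_le_mul h14 h15 hσ0.le (by positivity)
      have e : σ ^ 3 = σ ^ 2 * σ := by ring
      rw [e]
      refine h.trans_eq ?_
      ring
    rw [mul_one_div, mul_div_assoc', div_le_div_iff₀ (by positivity) (by positivity)]
    refine (mul_le_mul_of_nonneg_left h16 hM0).trans_eq ?_
    ring
  have e1 : 2 * R ^ 2 / (σ ^ 2) ^ 2 = 2 * (R ^ 2 / σ ^ 4) := by ring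
  have e2 : 5 * R ^ 2 / (8 * (σ ^ 2) ^ 2) = 5 / 8 * (R ^ 2 / σ ^ 4) := by ring
  have e3 : 216 * (1 + l) * M / σ ^ 3 = 216 * (1 + l) * M * (1 / σ ^ 3) := by ring
  have e4 : 300 * M / σ ^ 3 = 300 * (M * (1 / σ ^ 3)) := by ring
  rw [e1, e3] at h1
  rw [e2, e4] at h2
  have hRσ : 0 ≤ R ^ 2 / σ ^ 4 := by positivity
  have main : ∫ z, logPotential R n (x + z) ∂ν ≤ logPotential R n x - R ^ 2 / σ ^ 4 := by
    have h5 : E * (5 / 8 * (R ^ 2 / σ ^ 4)) ≤ 5 / 8 * (R ^ 2 / σ ^ 4) :=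
      mul_le_of_le_one_left (by positivity) hE1
    have h6 : E * (300 * (M * (1 / σ ^ 3))) ≤ 300 * (M * (1 / σ ^ 3)) :=
      mul_le_of_le_one_left (by positivity) hE1
    have h7 : 1 + Real.log (10 * n ^ 2) - l - E ≤ logPotential R n x := le_max_left _ _
    have e5 : 1 / (8 * σ ^ 2) = 1 / 8 * (1 / σ ^ 2) := by ring
    rw [e5] at h2 h10
    have h8 : E * (1 + 1 / 8 * (1 / σ ^ 2) - 5 / 8 * (R ^ 2 / σ ^ 4) - 300 * (M * (1 / σ ^ 3)))
        = E + E * (1 / 8 * (1 / σ ^ 2)) - E * (5 / 8 * (R ^ 2 / σ ^ 4))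
          - E * (300 * (M * (1 / σ ^ 3))) := by ring
    have h11 : (528 * M + 216 * M * l) * (1 / σ ^ 3)
        = 216 * (1 + l) * M * (1 / σ ^ 3) + 312 * (M * (1 / σ ^ 3)) := by ring
    linarith
  have hR2 : 0 ≤ R ^ 2 := sq_nonneg R
  -- At the pole `σ² = R²`, so the drift is at most `-1/R²`; the prefactor `R²` turns this into the
  -- required unit mass.
  split_ifs with hx0
  · have : R ^ 2 / σ ^ 4 = 1 / R ^ 2 := by
      have : σ ^ 2 = R ^ 2 := by rw [← hσ2, hx0, len_zero]; ring
      have h4 : σ ^ 4 = R ^ 2 * R ^ 2 := by rw [← this]; ring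
      rw [h4]
      field_simp
    rw [this] at main
    have h := mul_le_mul_of_nonneg_left main hR2
    rw [mul_sub, mul_one_div_cancel (by positivity)] at h
    linarith
  · rw [zero_add]
    exact mul_le_mul_of_nonneg_left (by linarith) hR2

end StepLaw

/-! ### Bounds for the Green's function of a disk -/

/-- `G` is the Green's function of the disk `D(0, n)`. -/
def IsDiskGreen (ν : Measure Z2) (n : ℝ) (G : Z2 → Z2 → ℝ) : Prop :=
  ∀ y ∈ disk 0 n, IsGreen ν (disk 0 n) y (G y)

namespace StepLaw

variable {ν : Measure Z2} [IsProbabilityMeasure ν]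

/-- The Green's function of a large disk is bounded below on a concentric smaller disk. -/
lemma exists_le_green_center (hν : StepLaw ν) :
    ∃ c > 0, ∀ᶠ n : ℝ in atTop, ∀ G, IsDiskGreen ν n G →
      ∀ y ∈ disk 0 (1 / 20 * n), ∀ x ∈ disk 0 (1 / 20 * n), c ≤ G y x := by
  obtain ⟨C, hC, r, hlog⟩ := hν.exists_log_subharmonic
  obtain ⟨c, hc, r', hharn⟩ := hν.exists_harnackAt_of_len_le r
  set S := (finite_disk_zero r).toFinset with hS
  have hSmem : ∀ w, w ∈ S ↔ len w < r := fun w => by rw [hS, Set.Finite.mem_toFinset, mem_disk_zero]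
  refine ⟨c / (C * (S.card + 1)), by positivity, ?_⟩
  filter_upwards [eventually_ge_atTop (max (max 20 (4 * r)) (4 * r'))] with n hn G hG
  have hn1 : 20 ≤ n := ((le_max_left _ _).trans (le_max_left _ _)).trans hn
  have hn2 : 4 * r ≤ n := ((le_max_right _ _).trans (le_max_left _ _)).trans hn
  have hn3 : 4 * r' ≤ n := (le_max_right _ _).trans hn
  suffices H : ∀ y ∈ disk 0 (1 / 20 * n), ∀ x ∈ disk 0 (1 / 20 * n),
      c / (C * (S.card + 1)) ≤ G x y from fun y hy x hx => H x hx y hy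
  intro y hy x hx
  rw [mem_disk_zero] at hy hx
  have hxD : x ∈ disk 0 n := mem_disk_zero.2 (by linarith)
  have hyw : ∀ w ∈ S, y + w ∈ disk 0 n := by
    intro w hw
    rw [hSmem] at hw
    exact mem_disk_zero.2 ((len_add_le y w).trans_lt (by linarith))
  have hfin := finite_disk_zero n
  -- The poles fill the disk `y + D(0, r)`, so the sum of Green's functions supplies exactly the
  -- indicator missing from superharmonicity of the corrected logarithm. The additive constant makes
  -- `f` nonnegative off the disk, where `|u - y| ≥ n/2`.
  set f : Z2 → ℝ := fun u => C * ∑ w ∈ S, G (y + w) u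
    + (regLog 1 (u - y) - Real.exp (-(regLog 1 (u - y) / 4)) + (1 - Real.log (n ^ 2 / 4))) with hf
  have hW : ∀ u, Integrable (fun z => ∑ w ∈ S, G (y + w) (u + z)) ν := fun u =>
    integrable_finsetSum _ fun w hw => (hG _ (hyw w hw)).integrable hfin u
  have hL : ∀ u, Integrable (fun z => regLog 1 (u - y + z)
      - Real.exp (-(regLog 1 (u - y + z) / 4))) ν := fun u =>
    (hν.integrable_regLog le_rfl _).sub (hν.integrable_exp_regLog le_rfl _)
  have hLc : ∀ u, Integrable (fun z => regLog 1 (u - y + z)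
      - Real.exp (-(regLog 1 (u - y + z) / 4)) + (1 - Real.log (n ^ 2 / 4))) ν := fun u =>
    (hL u).add (integrable_const _)
  have hfu : ∀ u z, f (u + z) = C * ∑ w ∈ S, G (y + w) (u + z)
      + (regLog 1 (u - y + z) - Real.exp (-(regLog 1 (u - y + z) / 4))
        + (1 - Real.log (n ^ 2 / 4))) := by
    intro u z
    rw [hf]
    simp only [show u + z - y = u - y + z by abel]
  have hpos : 0 ≤ f x := by
    refine hν.nonneg_of_superharmonic hfin (f := f) ?_ ?_ ?_ x
    · intro u _
      simp only [hfu]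
      exact ((hW u).const_mul C).add (hLc u)
    · intro u hu
      rw [mem_disk_zero, not_lt] at hu
      have h1 : ∑ w ∈ S, G (y + w) u = 0 := Finset.sum_eq_zero fun w hw =>
        (hG _ (hyw w hw)).off u (by rw [mem_disk_zero, not_lt]; exact hu)
      have h2 : n / 2 ≤ len (u - y) := by
        have := len_le_add_sub u y
        linarith
      have h3 : Real.log (n ^ 2 / 4) ≤ regLog 1 (u - y) := by
        refine Real.log_le_log (by positivity) ?_
        nlinarith
      have h4 : Real.exp (-(regLog 1 (u - y) / 4)) ≤ 1 := by
        rw [Real.exp_le_one_iff]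
        linarith [regLog_nonneg le_rfl (u - y)]
      rw [hf]
      simp only [h1]
      linarith
    · intro u hu
      simp only [hfu]
      rw [integral_add ((hW u).const_mul C) (hLc u), integral_const_mul,
        integral_add (hL u) (integrable_const _), integral_finsetSum _ fun w hw =>
          (hG _ (hyw w hw)).integrable hfin u]
      have h1 := hlog (u - y)
      have h2 : ∑ w ∈ S, ∫ z, G (y + w) (u + z) ∂ν
          = ∑ w ∈ S, G (y + w) u - (if len (u - y) < r then 1 else 0) := by
        have h3 : ∀ w ∈ S, ∫ z, G (y + w) (u + z) ∂ν
            = G (y + w) u - (if u - y = w then 1 else 0) := by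
          intro w hw
          rw [(hG _ (hyw w hw)).eq u hu]
          have : u = y + w ↔ u - y = w := by rw [sub_eq_iff_eq_add, add_comm]
          simp only [this]
          ring
        rw [Finset.sum_congr rfl h3, Finset.sum_sub_distrib, Finset.sum_ite_eq]
        simp only [hSmem]
      rw [h2, mul_sub]
      simp only [integral_const, probReal_univ, smul_eq_mul, one_mul, hf]
      linarith
  have hV : 1 ≤ C * ∑ w ∈ S, G (y + w) x := by
    -- Since `|x - y| ≤ n/10` and `n ≥ 20`, the logarithm at `x` lies at least `log 20 ≥ 2` below
    -- its boundary value, which leaves a surplus of one.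
    have h1 : regLog 1 (x - y) ≤ Real.log (n ^ 2 / 80) := by
      refine Real.log_le_log (by linarith [one_le_len_sq_add le_rfl (x - y)]) ?_
      have h2 : len (x - y) ≤ n / 10 := (len_sub_le x y).trans (by linarith)
      have h3 := pow_le_pow_left₀ (len_nonneg _) h2 2
      nlinarith
    have h4 : Real.log (n ^ 2 / 4) = Real.log (n ^ 2 / 80) + Real.log 20 := by
      rw [← Real.log_mul (by positivity) (by norm_num)]
      congr 1
      ring
    have h5 : 2 ≤ Real.log 20 := by
      rw [Real.le_log_iff_exp_le (by norm_num)]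
      have h6 : Real.exp 2 = Real.exp 1 * Real.exp 1 := by
        rw [← Real.exp_add]
        norm_num
      have h7 := Real.exp_one_lt_d9
      have h8 := Real.exp_pos 1
      nlinarith
    have h9 := Real.exp_pos (-(regLog 1 (x - y) / 4))
    rw [hf] at hpos
    simp only at hpos
    linarith
  have hterm : ∀ w ∈ S, c * G (y + w) x ≤ G x y := by
    intro w hw
    rw [IsGreen.symm hν hfin hxD (hyw w hw) (hG _ (hyw w hw)) (hG x hxD)]
    refine hharn w ((hSmem w).1 hw) (disk 0 n) y (G x) ?_ (hG x hxD).nonneg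
      (fun u _ => (hG x hxD).integrable hfin u) (fun u hu => (hG x hxD).integral_le hu)
    intro u hu
    rw [mem_disk_zero]
    have := len_le_add_sub u y
    linarith
  have hsum : c * ∑ w ∈ S, G (y + w) x ≤ S.card * G x y := by
    rw [Finset.mul_sum, ← nsmul_eq_mul]
    exact Finset.sum_le_card_nsmul _ _ _ hterm
  have h0 := (hG x hxD).nonneg y
  rw [div_le_iff₀ (by positivity)]
  have h1 : c * 1 ≤ c * (C * ∑ w ∈ S, G (y + w) x) := mul_le_mul_of_nonneg_left hV hc.le
  have h2 : C * (c * ∑ w ∈ S, G (y + w) x) ≤ C * (S.card * G x y) :=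
    mul_le_mul_of_nonneg_left hsum hC.le
  have h3 : 0 ≤ C * G x y := by positivity
  linarith

/-- A lower bound near the centre propagates to a lower bound linear in the distance to the
boundary. -/
lemma exists_le_green_of_center (hν : StepLaw ν) :
    ∃ c > 0, ∀ᶠ n : ℝ in atTop, ∀ G, IsDiskGreen ν n G → ∀ y ∈ disk 0 n, ∀ m ≥ 0,
      (∀ z ∈ disk 0 (1 / 20 * n), m ≤ G y z) →
        ∀ x ∈ disk 0 n, m * c * (1 - len x / n) ≤ G y x := by
  refine ⟨Real.exp (-500), Real.exp_pos _, ?_⟩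
  -- The exponent `500` satisfies `500 / 20² > 1`, the condition for subharmonicity outside `D(0,
  -- n/20)`.
  filter_upwards [hν.exp_barrier (l := 500) (s := 1 / 20) (by norm_num) (by norm_num)
    (by norm_num), eventually_gt_atTop 0] with n hbar hn G hG y hy m hm hGm x hx
  set E : Z2 → ℝ := fun u => Real.exp (500 * (1 - len u ^ 2 / n ^ 2)) with hE
  set κ := m * Real.exp (-500) with hκ
  have hκ0 : 0 ≤ κ := mul_nonneg hm (Real.exp_pos _).le
  have hfin : (disk 0 n \ disk 0 (1 / 20 * n)).Finite := (finite_disk_zero n).sdiff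
  have hGi := (hG y hy).integrable (finite_disk_zero n)
  have hmem : ∀ u ∈ disk 0 n \ disk 0 (1 / 20 * n), 1 / 20 * n ≤ len u ∧ len u ≤ n := by
    rintro u ⟨hu1, hu2⟩
    rw [mem_disk_zero] at hu1
    rw [mem_disk_zero, not_lt] at hu2
    exact ⟨hu2, hu1.le⟩
  have hpos : 0 ≤ G y x - κ * (E x - 1) := by
    refine hν.nonneg_of_superharmonic hfin (f := fun u => G y u - κ * (E u - 1)) ?_ ?_ ?_ x
    · intro u hu
      obtain ⟨hu1, hu2⟩ := hmem u hu
      exact (hGi u).sub (((hbar u hu1 hu2).1.sub (integrable_const 1)).const_mul κ)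
    · intro u hu
      by_cases h : u ∈ disk 0 n
      · have h' : u ∈ disk 0 (1 / 20 * n) := by
          by_contra h'
          exact hu ⟨h, h'⟩
        have h1 := hGm u h'
        have h2 : E u ≤ Real.exp 500 := by
          rw [hE, Real.exp_le_exp]
          have : 0 ≤ len u ^ 2 / n ^ 2 := by positivity
          linarith
        have h3 : κ * Real.exp 500 = m := by
          rw [hκ, mul_assoc, ← Real.exp_add]
          simp
        have := mul_le_mul_of_nonneg_left h2 hκ0
        linarith
      · have h1 := (hG y hy).off u h
        rw [mem_disk_zero, not_lt] at h
        have h2 : E u ≤ 1 := by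
          rw [hE, Real.exp_le_one_iff]
          have : 1 ≤ len u ^ 2 / n ^ 2 := by
            rw [one_le_div (by positivity)]
            exact pow_le_pow_left₀ hn.le h 2
          linarith
        simp only [h1]
        nlinarith
    · intro u hu
      obtain ⟨hu1, hu2⟩ := hmem u hu
      obtain ⟨hi, hle⟩ := hbar u hu1 hu2
      have hi1 : Integrable (fun z => E (u + z) - 1) ν := hi.sub (integrable_const 1)
      rw [integral_sub (hGi u) (hi1.const_mul κ), integral_const_mul,
        integral_sub hi (integrable_const 1)]
      have h1 := (hG y hy).integral_le hu.1
      have h2 := mul_le_mul_of_nonneg_left hle hκ0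
      simp only [integral_const, probReal_univ, smul_eq_mul, one_mul]
      linarith
  rw [mem_disk_zero] at hx
  have h1 := Real.add_one_le_exp (500 * (1 - len x ^ 2 / n ^ 2))
  have h2 : 1 - len x / n ≤ E x - 1 := by
    have ht0 : 0 ≤ len x / n := div_nonneg (len_nonneg x) hn.le
    have ht1 : len x / n ≤ 1 := (div_le_one hn).2 hx.le
    rw [← div_pow] at h1
    have : E x = Real.exp (500 * (1 - (len x / n) ^ 2)) := by rw [hE, div_pow]
    rw [this]
    nlinarith
  have := mul_le_mul_of_nonneg_left h2 hκ0
  linarith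

/-- The propagation lemma is applied with a central pole, evaluated at `y`; symmetry makes this a
central lower bound for the pole `y`, and the lemma is applied again. -/
lemma exists_le_green (hν : StepLaw ν) {δ : ℝ} (hδ : δ < 1) :
    ∃ c > 0, ∀ᶠ n : ℝ in atTop, ∀ G, IsDiskGreen ν n G → ∀ y ∈ disk 0 (δ * n), ∀ x ∈ disk 0 n,
      c * (1 - len x / n) ≤ G y x := by
  obtain ⟨m, hm, h1⟩ := hν.exists_le_green_center
  obtain ⟨c, hc, h2⟩ := hν.exists_le_green_of_center
  refine ⟨m * c * (1 - δ) * c, mul_pos (mul_pos (mul_pos hm hc) (by linarith)) hc, ?_⟩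
  filter_upwards [h1, h2, eventually_gt_atTop 0] with n h1 h2 hn G hG y hy x hx
  have hyD : y ∈ disk 0 n := by
    rw [mem_disk_zero] at hy ⊢
    nlinarith
  refine h2 G hG y hyD (m * c * (1 - δ)) (by have := sub_pos.2 hδ; positivity) (fun z hz => ?_) x hx
  have hzD : z ∈ disk 0 n := by
    rw [mem_disk_zero] at hz ⊢
    linarith
  rw [IsGreen.symm hν (finite_disk_zero n) hzD hyD (hG y hyD) (hG z hzD)]
  refine le_trans ?_ (h2 G hG z hzD m hm.le (fun w hw => h1 G hG z hz w hw) y hyD)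
  refine mul_le_mul_of_nonneg_left ?_ (by positivity)
  rw [mem_disk_zero] at hy
  have : len y / n ≤ δ := by
    rw [div_le_iff₀ hn]
    exact hy.le
  linarith

/-- Near the boundary the Green's function is at least of order `1 / n`. -/
lemma exists_le_green_boundary (hν : StepLaw ν) {δ ε : ℝ} (hδ : δ < 1) (hε : 0 < ε) :
    ∃ c > 0, ∀ᶠ n : ℝ in atTop, ∀ G, IsDiskGreen ν n G → ∀ y ∈ disk 0 (δ * n),
      ∀ x ∈ disk 0 n \ disk 0 (ε * n), c / n ≤ G y x := by
  obtain ⟨c, hc, h1⟩ := hν.exists_le_green hδ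
  set M := cubeMoment ν with hM
  have hM0 : 0 ≤ M := cubeMoment_nonneg ν
  -- With this choice `M / K² ≤ ε² / K`, so the cubic loss costs at most half of `2ε² / K`.
  set K := (M + 1) / ε ^ 2 with hK
  have hK0 : 0 < K := by positivity
  refine ⟨c * (ε ^ 2 / (4 * K)), by positivity, ?_⟩
  filter_upwards [h1, eventually_ge_atTop (4 * K / ε ^ 2), eventually_gt_atTop 0]
    with n h1 hnK hn G hG y hy x hx
  have hyD : y ∈ disk 0 n := by
    rw [mem_disk_zero] at hy ⊢
    nlinarith
  have hxn : len x < n := mem_disk_zero.1 hx.1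
  have hxε : ε * n ≤ len x := not_lt.1 fun h => hx.2 (mem_disk_zero.2 h)
  refine le_trans ?_ ((hG y hyD).integral_le hx.1)
  have hlow : ∀ w, c * ((n ^ 2 - len w ^ 2) / (2 * n ^ 2)) ≤ G y w := by
    intro w
    have hw0 := len_nonneg w
    by_cases hw : w ∈ disk 0 n
    · refine le_trans (mul_le_mul_of_nonneg_left ?_ hc.le) (h1 G hG y hy w hw)
      rw [mem_disk_zero] at hw
      rw [div_le_iff₀ (by positivity)]
      have : (1 - len w / n) * (2 * n ^ 2) = (n - len w) * (2 * n) := by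
        field_simp
      rw [this]
      nlinarith
    · rw [(hG y hyD).off w hw]
      rw [mem_disk_zero, not_lt] at hw
      refine mul_nonpos_of_nonneg_of_nonpos hc.le (div_nonpos_of_nonpos_of_nonneg ?_ (by positivity))
      nlinarith
  refine le_trans ?_ (hν.le_integral_of_taylorPoly_le ((hG y hyD).integrable
    (finite_disk_zero n) x) x 0 (-(c / (2 * n ^ 2))) (-(c / (2 * n ^ 2))) (c / (n ^ 3 * K))
    (-(c / (2 * n * K ^ 2))) fun z => ?_)
  · have h2 : M / K ^ 2 ≤ ε ^ 2 / K := by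
      rw [div_le_div_iff₀ (by positivity) hK0]
      have : ε ^ 2 * K = M + 1 := by
        rw [hK]
        field_simp
      nlinarith [mul_pos hK0 hK0]
    have h3 : 2 / n ≤ ε ^ 2 / (2 * K) := by
      rw [div_le_div_iff₀ hn (by positivity)]
      rw [div_le_iff₀ (by positivity)] at hnK
      linarith
    have h4 : ε ^ 2 ≤ len x ^ 2 / n ^ 2 := by
      rw [le_div_iff₀ (by positivity), ← mul_pow]
      exact pow_le_pow_left₀ (by positivity) hxε 2
    have h5 : 2 * ε ^ 2 / K ≤ 2 * (len x ^ 2 / n ^ 2) / K :=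
      div_le_div_of_nonneg_right (by linarith) hK0.le
    have e : 0 + 2 * -(c / (2 * n ^ 2)) + c / (n ^ 3 * K) * len x ^ 2
        + -(c / (2 * n * K ^ 2)) * cubeMoment ν
        = c / (2 * n) * (2 * (len x ^ 2 / n ^ 2) / K - M / K ^ 2 - 2 / n) := by
      rw [← hM]
      field_simp
      ring
    have e2 : c * (ε ^ 2 / (4 * K)) / n = c / (2 * n) * (ε ^ 2 / (2 * K)) := by
      field_simp
      ring
    rw [e, e2]
    refine mul_le_mul_of_nonneg_left ?_ (by positivity)
    have e3 : 2 * ε ^ 2 / K = ε ^ 2 / K + ε ^ 2 / (2 * K) + ε ^ 2 / (2 * K) := by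
      field_simp
      ring
    linarith
  · have hz0 := len_nonneg z
    set d := dot x z / n with hd
    have hdz : |d| ≤ len z := by
      rw [hd, abs_div, abs_of_pos hn, div_le_iff₀ hn, mul_comm]
      exact (abs_dot_le x z).trans (mul_le_mul_of_nonneg_right hxn.le hz0)
    have hdot : dot x z = d * n := by
      rw [hd]
      field_simp
    -- This is `|d| (K - |d|)² ≥ 0` rearranged. It bounds `E|d|` from below using only the second
    -- and third moments.
    have habs : 2 * d ^ 2 / K - len z ^ 3 / K ^ 2 ≤ |d| := by
      have h3 : |d| ^ 3 ≤ len z ^ 3 := pow_le_pow_left₀ (abs_nonneg d) hdz 3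
      have h4 : 2 * d ^ 2 / K - len z ^ 3 / K ^ 2 = (2 * |d| ^ 2 * K - len z ^ 3) / K ^ 2 := by
        rw [sq_abs]
        field_simp
      rw [h4, div_le_iff₀ (by positivity)]
      nlinarith [mul_nonneg (abs_nonneg d) (sq_nonneg (K - |d|))]
    have h0 := (hG y hyD).nonneg (x + z)
    have h2 := hlow (x + z)
    rw [len_add_sq, hdot] at h2
    have h3 : c / (2 * n) * (-2 * d - len z ^ 2 / n) ≤ G y (x + z) := by
      refine le_trans ?_ h2
      have : c / (2 * n) * (-2 * d - len z ^ 2 / n)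
          = c * ((-(2 * (d * n)) - len z ^ 2) / (2 * n ^ 2)) := by
        field_simp
      rw [this]
      refine mul_le_mul_of_nonneg_left (div_le_div_of_nonneg_right ?_ (by positivity)) hc.le
      nlinarith [len_nonneg x]
    have hcn : 0 < c / (2 * n) := by positivity
    -- Nonnegativity for outward steps and the linear bound for inward ones combine into `|d| - d`,
    -- twice the inward displacement.
    have h4 : c / (2 * n) * (|d| - d - len z ^ 2 / n) ≤ G y (x + z) := by
      rcases le_total 0 d with h | h
      · rw [abs_of_nonneg h]
        have : 0 ≤ c / (2 * n) * (len z ^ 2 / n) := by positivity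
        nlinarith
      · rw [abs_of_nonpos h]
        refine le_trans (le_of_eq ?_) h3
        ring
    refine le_trans ?_ h4
    refine le_trans (le_of_eq ?_) (mul_le_mul_of_nonneg_left
      (sub_le_sub_right (sub_le_sub_right habs d) (len z ^ 2 / n)) hcn.le)
    rw [hdot]
    field_simp
    ring

/-! ### The upper bound -/

lemma logPotential_le {R n : ℝ} (hR : 1 ≤ R) (hn : 1 ≤ n) (x : Z2) :
    logPotential R n x ≤ 13 * n := by
  have h1 := regLog_nonneg hR x
  have h2 := Real.exp_pos (-(regLog R x / 4))
  refine max_le ?_ (by linarith)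
  have h3 : Real.log (10 * n ^ 2) = Real.log 10 + 2 * Real.log n := by
    rw [Real.log_mul (by norm_num) (by positivity), Real.log_pow]
    norm_num
  have h4 := Real.log_le_sub_one_of_pos (by norm_num : (0 : ℝ) < 10)
  have h5 := Real.log_le_sub_one_of_pos (by linarith : 0 < n)
  linarith

lemma logPotential_le_of_le_len {R n γ : ℝ} (hn : 0 < n) (hγ : 0 < γ) {x : Z2}
    (hx : γ * n ≤ len x) : logPotential R n x ≤ 1 + |Real.log (10 / γ ^ 2)| := by
  have h2 := Real.exp_pos (-(regLog R x / 4))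
  refine max_le ?_ (by positivity)
  have h3 : Real.log (γ ^ 2 * n ^ 2) ≤ regLog R x := by
    refine Real.log_le_log (by positivity) ?_
    rw [← mul_pow]
    have := pow_le_pow_left₀ (by positivity) hx 2
    nlinarith [sq_nonneg R]
  have h4 : Real.log (10 * n ^ 2) = Real.log (10 / γ ^ 2) + Real.log (γ ^ 2 * n ^ 2) := by
    rw [← Real.log_mul (by positivity) (by positivity)]
    congr 1
    field_simp
  have h5 := le_abs_self (Real.log (10 / γ ^ 2))
  linarith

lemma rootBarrier_disk_le {a n t : ℝ} (ha : 1 ≤ a) (ht : 0 ≤ t) (htn : t < n) :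
    rootBarrier ((n ^ 2 - t ^ 2) / n + a) ≤ 2 * (2 + a) * max (n - t) 1 := by
  have hn : 0 < n := by linarith
  have h0 : 0 ≤ (n ^ 2 - t ^ 2) / n := div_nonneg (by nlinarith) hn.le
  have h2 : (n ^ 2 - t ^ 2) / n ≤ 2 * (n - t) := by
    rw [div_le_iff₀ hn]
    nlinarith
  have h4 := le_max_left (n - t) 1
  have h5 := mul_le_mul_of_nonneg_left (le_max_right (n - t) 1) (by linarith : 0 ≤ a)
  have h6 : rootBarrier ((n ^ 2 - t ^ 2) / n + a) ≤ 2 * ((n ^ 2 - t ^ 2) / n + a) :=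
    rootBarrier_le (by linarith)
  linarith

/-- Upper bound for the Green's function, linear in the distance to the boundary. -/
lemma exists_green_le (hν : StepLaw ν) {R δ ε : ℝ} (hR : 1 ≤ R) (hδ : 0 < δ) (hδε : δ < ε)
    (hε : ε < 1) :
    ∃ c > 0, ∀ᶠ n : ℝ in atTop, ∀ G, IsDiskGreen ν n G →
      (∀ y ∈ disk 0 n, ∀ w, G y w ≤ R ^ 2 * logPotential R n (w - y)) →
      ∀ y ∈ disk 0 (δ * n), ∀ x ∈ disk 0 n \ disk 0 (ε * n),
        G y x ≤ c * (max (n - len x) 1 / n) := by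
  -- The radii `δn`, `(δ + γ)n`, `(ε - γ)n` and `εn` are spaced by `γn`: the first gap keeps the
  -- pole away, and the second makes jumps from the annulus into the inner region rare.
  set γ := (ε - δ) / 3 with hγ
  have hγ0 : 0 < γ := by rw [hγ]; linarith
  set M := cubeMoment ν with hM
  have hM0 : 0 ≤ M := cubeMoment_nonneg ν
  obtain ⟨a, ha, hbar⟩ := hν.exists_boundary_barrier (η := ε - γ) (by linarith)
  set C₀ := R ^ 2 * (1 + |Real.log (10 / γ ^ 2)|) with hC₀
  have hC₀0 : 0 ≤ C₀ := by positivity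
  set C₁ := 13 * R ^ 2 with hC₁
  -- The first summand gives domination on the inner region, the second lets the barrier's drift
  -- absorb the long jumps.
  set K := C₀ / (1 - (ε - γ) ^ 2) + C₁ * M / γ ^ 3 + 1 with hK
  have hεγ : 0 < 1 - (ε - γ) ^ 2 := by nlinarith
  have hK1 : C₀ ≤ K * (1 - (ε - γ) ^ 2) := by
    have h1 : C₀ / (1 - (ε - γ) ^ 2) ≤ K := by
      have : 0 ≤ C₁ * M / γ ^ 3 := by positivity
      linarith
    rwa [div_le_iff₀ hεγ] at h1
  have hK2 : C₁ * M / γ ^ 3 ≤ K := by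
    have : 0 ≤ C₀ / (1 - (ε - γ) ^ 2) := by positivity
    linarith
  have hK0 : 0 < K := by
    have h1 : 0 ≤ C₁ * M / γ ^ 3 := by positivity
    have h2 : 0 ≤ C₀ / (1 - (ε - γ) ^ 2) := by positivity
    linarith
  refine ⟨2 * K * (2 + a), by positivity, ?_⟩
  filter_upwards [eventually_ge_atTop a] with n hna G hG hGU y hy x hx
  have hn1 : 1 ≤ n := by linarith
  have hn : 0 < n := by linarith
  have hγn : (δ + γ) * n ≤ (ε - γ) * n :=
    mul_le_mul_of_nonneg_right (by rw [hγ]; linarith) hn.le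
  obtain ⟨hi', hle'⟩ : (∀ u, (ε - γ) * n ≤ len u → len u ≤ n →
      Integrable (fun z => rootBarrier ((n ^ 2 - len (u + z) ^ 2) / n + a)) ν) ∧
      ∀ u, (ε - γ) * n ≤ len u → len u ≤ n →
      ∫ z, rootBarrier ((n ^ 2 - len (u + z) ^ 2) / n + a) ∂ν
        ≤ rootBarrier ((n ^ 2 - len u ^ 2) / n + a) - 2 / n :=
    ⟨fun u h1 h2 => (hbar n hna u h1 h2).1, fun u h1 h2 => (hbar n hna u h1 h2).2⟩
  rw [mem_disk_zero] at hy
  have hyD : y ∈ disk 0 n := by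
    rw [mem_disk_zero]
    nlinarith
  have hfin : (disk 0 n \ disk 0 ((ε - γ) * n)).Finite := (finite_disk_zero n).sdiff
  set g := G y with hg
  have hgG := hG y hyD
  rw [← hg] at hgG
  have hg1 : ∀ w, g w ≤ C₁ * n := fun w => (hGU y hyD w).trans (by
    have := mul_le_mul_of_nonneg_left (logPotential_le hR hn1 (w - y)) (sq_nonneg R)
    linarith)
  have hg0 : ∀ w, (δ + γ) * n ≤ len w → g w ≤ C₀ := by
    intro w hw
    refine (hGU y hyD w).trans (mul_le_mul_of_nonneg_left
      (logPotential_le_of_le_len hn hγ0 ?_) (sq_nonneg R))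
    have := len_le_add_sub w y
    linarith
  -- The Green's function is cut off near its pole, where only the bound `C₁ n` is available and the
  -- barrier need not dominate.
  set g' : Z2 → ℝ := fun w => if (δ + γ) * n ≤ len w then g w else 0 with hg'
  have hgi' : ∀ u, Integrable (fun z => g' (u + z)) ν := fun u =>
    integrable_of_finite_support (finite_disk_zero n)
      (fun w hw => by simp [hg', hgG.off w hw]) u
  set H : Z2 → ℝ := fun w => rootBarrier ((n ^ 2 - len w ^ 2) / n + a) with hH
  have hmem : ∀ u ∈ disk 0 n \ disk 0 ((ε - γ) * n), (ε - γ) * n ≤ len u ∧ len u ≤ n := by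
    rintro u ⟨hu1, hu2⟩
    rw [mem_disk_zero] at hu1
    rw [mem_disk_zero, not_lt] at hu2
    exact ⟨hu2, hu1.le⟩
  have hpos : 0 ≤ K / n * H x - g' x := by
    refine hν.nonneg_of_superharmonic hfin (f := fun u => K / n * H u - g' u) ?_ ?_ ?_ x
    · intro u hu
      obtain ⟨hu1, hu2⟩ := hmem u hu
      exact ((hi' u hu1 hu2).const_mul _).sub (hgi' u)
    · intro u hu
      have hH0 : 0 ≤ H u := rootBarrier_nonneg _
      by_cases h : u ∈ disk 0 n
      · have h' : len u < (ε - γ) * n := by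
          rw [← mem_disk_zero]
          by_contra h'
          exact hu ⟨h, h'⟩
        have h1 : g' u ≤ C₀ := by
          rw [hg']
          simp only
          split_ifs with h2
          · exact hg0 u h2
          · exact hC₀0
        have h2 : n * (1 - (ε - γ) ^ 2) ≤ H u := by
          refine le_trans ?_ (le_rootBarrier _)
          have h3 : n * (1 - (ε - γ) ^ 2) ≤ (n ^ 2 - len u ^ 2) / n := by
            rw [le_div_iff₀ hn]
            have := pow_le_pow_left₀ (len_nonneg u) h'.le 2
            nlinarith
          linarith
        have h4 := mul_le_mul_of_nonneg_left h2 (by positivity : 0 ≤ K / n)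
        have h5 : K / n * (n * (1 - (ε - γ) ^ 2)) = K * (1 - (ε - γ) ^ 2) := by
          field_simp
        linarith
      · have h1 : g' u = 0 := by simp [hg', hgG.off u h]
        simp only [h1, sub_zero]
        positivity
    · intro u hu
      obtain ⟨hu1, hu2⟩ := hmem u hu
      rw [integral_sub ((hi' u hu1 hu2).const_mul _) (hgi' u), integral_const_mul]
      have h1 := mul_le_mul_of_nonneg_left (hle' u hu1 hu2) (by positivity : 0 ≤ K / n)
      have hgu : g' u = g u := if_pos (hγn.trans hu1)
      have huy : u ≠ y := by
        rintro rfl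
        linarith [mul_pos hγ0 hn]
      have hgeq := hgG.eq u hu.1
      rw [if_neg huy, zero_add] at hgeq
      -- Reaching the cut-off region takes a jump of length at least `γn`. By a cubic Markov bound
      -- the lost mass is at most `C₁ n · M / (γn)³`, of the same order `n⁻²` as the drift of `K/n`
      -- times the barrier.
      have h2 : ∫ z, g (u + z) ∂ν - C₁ * M / (γ ^ 3 * n ^ 2) ≤ ∫ z, g' (u + z) ∂ν := by
        have hc := hν.integrable_cube.const_mul (C₁ / (γ ^ 3 * n ^ 2))
        have e : ∫ z, g (u + z) ∂ν - C₁ * M / (γ ^ 3 * n ^ 2)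
            = ∫ z, (g (u + z) - C₁ / (γ ^ 3 * n ^ 2) * len z ^ 3) ∂ν := by
          rw [integral_sub (hgG.integrable (finite_disk_zero n) u) hc, integral_const_mul, hM,
            cubeMoment]
          ring
        rw [e]
        refine integral_mono ((hgG.integrable (finite_disk_zero n) u).sub hc) (hgi' u) fun z => ?_
        have hz0 : 0 ≤ C₁ / (γ ^ 3 * n ^ 2) * len z ^ 3 :=
          mul_nonneg (by positivity) (pow_nonneg (len_nonneg z) 3)
        simp only [hg']
        split_ifs with h3
        · linarith
        · have h4 : γ * n ≤ len z := by
            have h5 : len u ≤ len (u + z) + len z := by simpa using len_sub_le (u + z) z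
            rw [not_le] at h3
            rw [hγ] at hu1 h3 ⊢
            linarith
          have h6 := pow_le_pow_left₀ (by positivity) h4 3
          have h7 : C₁ * n ≤ C₁ / (γ ^ 3 * n ^ 2) * len z ^ 3 := by
            refine le_trans (le_of_eq ?_) (mul_le_mul_of_nonneg_left h6 (by positivity))
            field_simp
          linarith [hg1 (u + z)]
      have h3 : C₁ * M / (γ ^ 3 * n ^ 2) ≤ K / n * (2 / n) := by
        have h4 : C₁ * M / (γ ^ 3 * n ^ 2) = C₁ * M / γ ^ 3 * (1 / n ^ 2) := by
          field_simp
        have h5 : K / n * (2 / n) = 2 * K * (1 / n ^ 2) := by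
          field_simp
        rw [h4, h5]
        exact mul_le_mul_of_nonneg_right (by linarith) (by positivity)
      simp only [hgu]
      rw [mul_sub] at h1
      linarith
  have hxn : len x < n := mem_disk_zero.1 hx.1
  have hxε : ε * n ≤ len x := not_lt.1 fun h => hx.2 (mem_disk_zero.2 h)
  have hgx : g' x = g x := if_pos (hγn.trans (le_trans (by nlinarith) hxε))
  have h3 : H x ≤ 2 * (2 + a) * max (n - len x) 1 := rootBarrier_disk_le ha (len_nonneg x) hxn
  have h4 := mul_le_mul_of_nonneg_left h3 (by positivity : 0 ≤ K / n)
  have h5 : K / n * (2 * (2 + a) * max (n - len x) 1)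
      = 2 * K * (2 + a) * (max (n - len x) 1 / n) := by
    field_simp
  rw [hgx] at hpos
  linarith

end StepLaw

/-! ### Assembly of the two bounds -/

theorem lemma2p2 {Ω : Type*} [MeasurableSpace Ω] (μ : Measure Ω) [IsProbabilityMeasure μ]
    (β : ℝ) (hβ : 0 < β) (ξ : ℕ → Ω → Z2) (hξ : IsWalkSteps μ β ξ)
    (δ ε : ℝ) (hδ : 0 < δ) (hδε : δ < ε) (hε : ε < 1) :
    ∃ c₁ c₂ : ℝ, 0 < c₁ ∧ c₁ < c₂ ∧
      ∀ᶠ n : ℝ in atTop, ∀ x ∈ disk 0 n \ disk 0 (ε * n), ∀ y ∈ disk 0 (δ * n),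
        ENNReal.ofReal (c₁ * (max (n - Z2.len x) 1 / n)) ≤ green μ ξ (disk 0 n) y x ∧
        green μ ξ (disk 0 n) y x ≤ ENNReal.ofReal (c₂ * (max (n - Z2.len x) 1 / n)) := by
  have hν := hξ.stepLaw hβ
  have : IsProbabilityMeasure (μ.map (ξ 0)) :=
    Measure.isProbabilityMeasure_map (hξ.measurable 0).aemeasurable
  obtain ⟨R, hR, hU⟩ := hν.exists_logPotential_supersolution
  obtain ⟨a, ha, hlow⟩ := hν.exists_le_green (hδε.trans hε)
  obtain ⟨b, hb, hbdy⟩ := hν.exists_le_green_boundary (hδε.trans hε) (hδ.trans hδε)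
  obtain ⟨c, hc, hup⟩ := hν.exists_green_le hR hδ hδε hε
  -- Adding `min a b` to the upper constant enforces `c₁ < c₂` strictly.
  refine ⟨min a b, min a b + c, lt_min ha hb, by linarith, ?_⟩
  filter_upwards [hlow, hbdy, hup, eventually_ge_atTop R] with n hlow hbdy hup hnR x hx y hy
  have hn : 0 < n := by linarith
  have hex : ∀ y, ∃ g : Z2 → ℝ, y ∈ disk 0 n → IsGreen (μ.map (ξ 0)) (disk 0 n) y g ∧
      (∀ w, g w ≤ R ^ 2 * logPotential R n (w - y)) ∧
      ∀ w, green μ ξ (disk 0 n) y w = ENNReal.ofReal (g w) := by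
    intro y
    by_cases hy : y ∈ disk 0 n
    · have hs : ∀ w ∈ disk 0 n, len (w - y) ≤ 2 * n := by
        intro w hw
        rw [mem_disk_zero] at hw hy
        exact (len_sub_le w y).trans (by linarith)
      have hadd : ∀ w z : Z2, w + z - y = w - y + z := fun w z => by abel
      obtain ⟨g, hg⟩ := hξ.exists_isGreen hy (U := fun w => R ^ 2 * logPotential R n (w - y))
        (fun w => mul_nonneg (sq_nonneg R) (le_max_right _ _))
        (fun w hw => by
          simp only [hadd]
          exact (hU n hnR _ (hs w hw)).1.const_mul _)
        (fun w hw => by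
          simp only [hadd]
          rw [integral_const_mul]
          simpa [sub_eq_zero] using (hU n hnR _ (hs w hw)).2)
      exact ⟨g, fun _ => hg⟩
    · exact ⟨0, fun h => absurd h hy⟩
  choose G hG using hex
  have hGG : IsDiskGreen (μ.map (ξ 0)) n G := fun y hy => (hG y hy).1
  have hyD : y ∈ disk 0 n := by
    rw [mem_disk_zero] at hy ⊢
    nlinarith
  have hmax : 0 ≤ max (n - len x) 1 / n := div_nonneg (le_max_of_le_right zero_le_one) hn.le
  rw [(hG y hyD).2.2 x]
  refine ⟨ENNReal.ofReal_le_ofReal ?_, ENNReal.ofReal_le_ofReal ?_⟩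
  · rcases le_total (n - len x) 1 with h | h
    · rw [max_eq_right h, mul_one_div]
      exact (div_le_div_of_nonneg_right (min_le_right a b) hn.le).trans (hbdy G hGG y hy x hx)
    · rw [max_eq_left h]
      have hx' : len x < n := mem_disk_zero.1 hx.1
      have h1 := hlow G hGG y hy x hx.1
      have h2 : (n - len x) / n = 1 - len x / n := by
        field_simp
      rw [h2]
      refine (mul_le_mul_of_nonneg_right (min_le_left a b) ?_).trans h1
      rw [← h2]
      exact div_nonneg (by linarith) hn.le
  · refine (hup G hGG (fun y hy => (hG y hy).2.1) y hy x hx).trans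
      (mul_le_mul_of_nonneg_right ?_ hmax)
    linarith [lt_min ha hb]
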